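/- **Setting.** Let $\mathcal S,\mathcal A$ be finite, $\rho\in\Delta(\mathcal S)$ a prompt distribution, $\pi_{\rm ref}$ a reference policy with $\pi_{\rm ref}(a|s)>0$, $\beta>0$, and $r^*:\mathcal S\times\mathcal A\to[0,R]$ the true reward. Write $\mathbb E_{\rho,\pi}[r]=\mathbb E_{s\sim\rho,a\sim\pi(\cdot|s)}[r(s,a)]$, $\mathrm{KL}(\pi\|\pi_{\rm ref})=\mathbb E_{\rho,\pi}[\log\frac{\pi}{\pi_{\rm ref}}]$, $J(\pi)=\mathbb E_{\rho,\pi}[r^*]-\beta\,\mathrm{KL}(\pi\|\pi_{\rm ref})$, $\pi^*_r(a|s)\propto\pi_{\rm ref}(a|s)e^{r(s,a)/\beta}$ (the maximizer of the objective $\mathbb E_{\rho,\pi}[r]-\beta\,\mathrm{KL}(\pi\|\pi_{\rm ref})$), $\mathrm{Cov}^{\pi'|\pi}=\mathbb E_{s\sim\rho,a\sim\pi'}[\pi'(a|s)/\pi(a|s)]$, and $\sigma$ for the sigmoid. Let $\Pi$ be a finite class of policies with $\pi^*_{r^*}\in\Pi$ and, for all $\pi\in\Pi$, $\pi>0$ and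 $\max_{s,a}|\log\frac{\pi(a|s)}{\pi_{\rm ref}(a|s)}|\le R/\beta$. Let $\mathrm{conv}(\Pi)$ be its convex hull and $\mathcal R^\Pi=\{r_{|\pi}:\pi\in\Pi\}$ with $r_{|\pi}(s,a)=\mathrm{Clip}_{[0,R]}\big[\beta\log\frac{\pi(a|s)}{\pi_{\rm ref}(a|s)}-\min_{a'}\beta\log\frac{\pi(a'|s)}{\pi_{\rm ref}(a'|s)}\big]$. A dataset is $\mathcal D=\{(s^i,a^i,\tilde a^i,y^i,\pi^i)\}_{i\le|\mathcal D|}$, with mixture $\pi^{\mathcal D}_{\rm mix}=\frac1{|\mathcal D|}\sum_i\pi^i$ and average negative log-likelihood $L_{\mathcal D}(r)=\frac1{|\mathcal D|}\sum_i\big[-y^i\log\sigma(r(s^i,a^i)-r(s^i,\tilde a^i))-(1-y^i)\log\sigma(r(s^i,\tilde a^i)-r(s^i,a^i))\big]$. **TPS.** Given source rewards $r^1,\dots,r^W$, a horizon $T$, $\delta\in(0,1)$, a constant $c$, and $\mathcal D$, put $\eta=c(1+e^R)^{-2}\sqrt{\frac1{|\mathcal D|}\log\frac{|\Pi|T}\delta}$.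 Let $\hat r_{\rm MLE}\in\arg\min_{\mathcal R^\Pi}L_{\mathcal D}$; let $\pi_{\rm Dstl}\in\mathrm{conv}(\Pi)$ maximize $\min_{r\in\mathcal R^\Pi}F(\pi,r)$, where $F(\pi,r)=L_{\mathcal D}(r)+\eta\big(\mathbb E_{\rho,\pi}[r]-\mathbb E_{\rho,\pi_{\rm ref}}[r]-\beta\,\mathrm{KL}(\pi\|\pi_{\rm ref})\big)$, and let $\hat r_{\rm Dstl}\in\mathcal R^\Pi$ minimize $F(\pi_{\rm Dstl},\cdot)$. Put $$\hat V(\pi_{\rm Dstl};\mathcal D)=\mathbb E_{\rho,\pi_{\rm Dstl}}[\hat r_{\rm Dstl}]-\mathbb E_{\rho,\pi_{\rm ref}}[\hat r_{\rm Dstl}]-\beta\,\mathrm{KL}(\pi_{\rm Dstl}\|\pi_{\rm ref})+\tfrac1\eta L_{\mathcal D}(\hat r_{\rm Dstl})-\tfrac1\eta L_{\mathcal D}(\hat r_{\rm MLE})-2ce^{2R}\sqrt{\tfrac1{|\mathcal D|}\log\tfrac{|\Pi|T}\delta},$$ $$\hat V(\pi^*_{r^w};\mathcal D)=\mathbb E_{\rho,\pi^*_{r^w}}[\hat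 r_{\rm MLE}]-\mathbb E_{\rho,\pi_{\rm ref}}[\hat r_{\rm MLE}]-\beta\,\mathrm{KL}(\pi^*_{r^w}\|\pi_{\rm ref})+16e^{2R}\sqrt{\tfrac1{N(w;\mathcal D)}\log\tfrac{|\Pi|WT}\delta},$$ with $N(w;\mathcal D)=\#\{i:\pi^i=\pi^*_{r^w}\}$ and $1/0=+\infty$. TPS returns a policy with the largest $\hat V$ among $\pi^*_{r^1},\dots,\pi^*_{r^W},\pi_{\rm Dstl}$. Ties are broken arbitrarily. **Online oracle.** $\mathrm{Alg}_{\rm OL}(\tilde T,\delta';\cdot)$ is a (possibly randomized) rule choosing the next policy in $\mathrm{conv}(\Pi)$ from the data it has collected so far, such that for all $\tilde T$ and $\delta'\in(0,1)$, with probability at least $1-\delta'$, $\sum_{i\le t}(J(\pi^*_{r^*})-J(\pi^i))\le C_{\rm OL}Re^{2R}\sqrt{\mathcal C(\Pi)\,t\log^{c_0}\frac{|\Pi|\tilde T}{\delta'}}$ for all $t\le\tilde T$, where the data are collected as in TPO below. Here $C_{\rm OL}>0$, $c_0\ge1$ are absolute constants and $\mathcal C(\Pi)$ is a real number (a complexity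 measure of $\Pi$). **TPO.** There are $K$ blocks of $N$ iterations, $T=KN$, and $\alpha\in(0,1)$ with $\alpha N\ge1$. In iteration $n$ of block $k$ the policy $\pi^{k,n}$ is chosen by $\mathrm{Alg}_{\rm OL}(K\lfloor\alpha N\rfloor,\delta_0;\cdot)$ from the data of the earlier online iterations if $n\le\alpha N$, and by TPS (with $T$, $\delta$) from all data collected before if $n>\alpha N$. Then $s\sim\rho$, $a\sim\pi^{k,n}(\cdot|s)$, $\tilde a\sim\pi_{\rm ref}(\cdot|s)$ and $y\in\{0,1\}$ with $\Pr(y=1)=\sigma(r^*(s,a)-r^*(s,\tilde a))$ are drawn. Here $0<\delta_0\le\delta<1$. **Lemma (value estimation error for $\pi_{\rm Dstl}$).** For all $c\ge\sqrt{24}$, $C_{\rm OL}>0$, $c_0\ge1$ there is a constant $c'>0$, depending on these three numbers only, such that in every such setting the following holds with probability at least $1-\frac\delta2-\delta_0$ (hence at least $1-\delta$ if $\delta_0=\delta/2$): in every call of TPS during TPO, with $\mathcal D$ the dataset of that call, $$J(\pi^*_{r^*})-J(\pi_{\rm ref})-c'\,\bar R\,e^{2R}\Big(\mathrm{Cov}^{\pi^*_{r^*}|\pi^{\mathcal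 D}_{\rm mix}}\wedge\frac{\sqrt{\bar{\mathcal C}}}{\alpha}\Big)\sqrt{\frac1{|\mathcal D|}\log^{c_0}\frac{|\Pi|T}{\delta_0}}\ \le\ \hat V(\pi_{\rm Dstl};\mathcal D)\ \le\ J(\pi_{\rm Dstl})-J(\pi_{\rm ref}),$$ where $\bar R=\max\{1,R\}$ and $\bar{\mathcal C}=\max\{1,\mathcal C(\Pi)\}$. -/

import Mathlib

open MeasureTheory ProbabilityTheory

universe u v w

noncomputable section

namespace RLHF

/-- A (stochastic) policy, written as the table of its probabilities `π s a = π(a|s)`. -/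
abbrev Policy (S A : Type*) := S → A → ℝ

/-- A reward model `r s a = r(s,a)`. -/
abbrev Reward (S A : Type*) := S → A → ℝ

/-- `π(·|s)` is a probability distribution on the actions for every prompt `s`. -/
def IsPolicy {S A : Type*} [Fintype A] (π : Policy S A) : Prop :=
  ∀ s, π s ∈ stdSimplex ℝ A

/-- One observation: a prompt `s`, two responses `a`, `b`, and the preference label `y`
(`y = true` means that `a` is preferred to `b`). -/
structure Obs (S A : Type*) where
  s : S
  a : A
  b : A
  y : Bool

/-- Observations form a finite set below, so they carry the discrete σ-algebra. -/
instance (S A : Type*) : MeasurableSpace (Obs S A) := ⊤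

/-- One entry `(s, a, ã, y, π)` of a dataset. -/
abbrev Step (S A : Type*) := Obs S A × Policy S A

/-- A dataset with `m` entries. -/
abbrev Dataset (S A : Type*) (m : ℕ) := Fin m → Step S A

/-- A KL-regularised contextual bandit with preference feedback. -/
structure Problem (S A : Type*) [Fintype S] [Fintype A] where
  /-- prompt distribution -/
  ρ : S → ℝ
  ρ_mem : ρ ∈ stdSimplex ℝ S
  /-- reference policy -/
  πref : Policy S A
  πref_policy : IsPolicy πref
  πref_pos : ∀ s a, 0 < πref s a
  /-- regularisation strength -/
  β : ℝ
  β_pos : 0 < β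
  /-- reward range -/
  R : ℝ
  /-- true reward -/
  rstar : Reward S A
  rstar_mem : ∀ s a, rstar s a ∈ Set.Icc 0 R

namespace Problem

variable {S A : Type*} [Fintype S] [Fintype A] (P : Problem S A)

/-- `E_{s∼ρ, a∼π}[f(s,a)]`. -/
def expect (π : Policy S A) (f : S → A → ℝ) : ℝ :=
  ∑ s, P.ρ s * ∑ a, π s a * f s a

/-- `KL(π‖π_ref) = E_{s∼ρ, a∼π}[log (π(a|s)/π_ref(a|s))]`. -/
def kl (π : Policy S A) : ℝ :=
  P.expect π fun s a => Real.log (π s a / P.πref s a)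

/-- The regularised value `J_β(π)` under the true reward. -/
def J (π : Policy S A) : ℝ := P.expect π P.rstar - P.β * P.kl π

/-- The optimal policy `π*_r` of the regularised objective with reward `r`, in its closed form
`π*_r(a|s) ∝ π_ref(a|s) exp(r(s,a)/β)`. -/
def opt (r : Reward S A) : Policy S A := fun s a =>
  P.πref s a * Real.exp (r s a / P.β) / ∑ b, P.πref s b * Real.exp (r s b / P.β)

/-- Coverage coefficient `Cov^{π'|π} = E_{s∼ρ, a∼π'}[π'(a|s)/π(a|s)]`. -/
def cov (π' π : Policy S A) : ℝ := P.expect π' fun s a => π' s a / π s a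

/-- Assumption on the finite policy class: realizability and bounded policy ratio. -/
structure GoodClass (Pi : Finset (Policy S A)) : Prop where
  policy : ∀ π ∈ Pi, IsPolicy π
  realizable : P.opt P.rstar ∈ Pi
  pos : ∀ π ∈ Pi, ∀ s a, 0 < π s a
  ratio : ∀ π ∈ Pi, ∀ s a, |Real.log (π s a / P.πref s a)| ≤ P.R / P.β

/-- The reward model
`r_{|π}(s,a) = Clip_{[0,R]}[β log(π/π_ref)(a|s) - min_{a'} β log(π/π_ref)(a'|s)]`. -/
def rewardOf (π : Policy S A) : Reward S A := fun s a =>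
  max 0 (min P.R (P.β * Real.log (π s a / P.πref s a)
    - ⨅ a', P.β * Real.log (π s a' / P.πref s a')))

/-- The reward class `R^Π` induced by the policy class. -/
def rewardClass (Pi : Finset (Policy S A)) : Set (Reward S A) := P.rewardOf '' (Pi : Set _)

/-- Probability of the observation `x` when `s∼ρ`, `a∼π(·|s)`, `ã∼π_ref(·|s)` and the label follows
the Bradley--Terry model with the true reward. -/
def obsProb (π : Policy S A) (x : Obs S A) : ℝ :=
  P.ρ x.s * π x.s x.a * P.πref x.s x.b *
    (if x.y then Real.sigmoid (P.rstar x.s x.a - P.rstar x.s x.b)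
      else Real.sigmoid (P.rstar x.s x.b - P.rstar x.s x.a))

end Problem

section Data

variable {S A : Type*} {m : ℕ}

/-- Average negative log-likelihood `L_D(r)`. -/
def nll (D : Dataset S A m) (r : Reward S A) : ℝ :=
  (1 / (m : ℝ)) * ∑ i, (if (D i).1.y
    then -Real.log (Real.sigmoid (r (D i).1.s (D i).1.a - r (D i).1.s (D i).1.b))
    else -Real.log (Real.sigmoid (r (D i).1.s (D i).1.b - r (D i).1.s (D i).1.a)))

/-- The uniform mixture `(1/|D|) ∑ᵢ πⁱ` of the policies in a dataset. -/
def mixture (D : Dataset S A m) : Policy S A := fun s a => (1 / (m : ℝ)) * ∑ i, (D i).2 s a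

open Classical in
/-- The number of entries of `D` that were collected with the policy `π`. -/
def countPolicy (D : Dataset S A m) (π : Policy S A) : ℕ :=
  (Finset.univ.filter fun i => (D i).2 = π).card

end Data

namespace Problem

variable {S A : Type*} [Fintype S] [Fintype A] (P : Problem S A) {m : ℕ}

/-- The RPO objective
`L_D(r) + η (E_{s∼ρ, a∼π, ã∼π_ref}[r(s,a) - r(s,ã)] - β KL(π‖π_ref))`. -/
def rpoObj (D : Dataset S A m) (η : ℝ) (π : Policy S A) (r : Reward S A) : ℝ :=
  nll D r + η * (P.expect π r - P.expect P.πref r - P.β * P.kl π)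

/-- `(π, r)` is an output of `RPO(conv Π, R^Π, D, η)`: `π` attains the max over `conv Π` of the min
over `R^Π` of the objective, and `r` attains the inner min at `π`. -/
structure IsRPO (Pi : Finset (Policy S A)) (D : Dataset S A m) (η : ℝ)
    (π : Policy S A) (r : Reward S A) : Prop where
  mem : π ∈ convexHull ℝ (Pi : Set (Policy S A))
  max : IsMaxOn (fun π' => sInf (P.rpoObj D η π' '' P.rewardClass Pi))
    (convexHull ℝ (Pi : Set (Policy S A))) π
  mem_reward : r ∈ P.rewardClass Pi
  min : IsMinOn (P.rpoObj D η π) (P.rewardClass Pi) r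

/-- `r` is a maximum-likelihood reward in `R^Π`. -/
def IsMLE (Pi : Finset (Policy S A)) (D : Dataset S A m) (r : Reward S A) : Prop :=
  r ∈ P.rewardClass Pi ∧ IsMinOn (nll D) (P.rewardClass Pi) r

/-- `η = c (1+e^R)⁻² √((1/|D|) log(|Π|T/δ))`. -/
def eta (Pi : Finset (Policy S A)) (c δ : ℝ) (T m : ℕ) : ℝ :=
  c * ((1 + Real.exp P.R) ^ 2)⁻¹ * √(1 / (m : ℝ) * Real.log (Pi.card * T / δ))

/-- The pessimistic estimate of the value gain of the self-transfer policy, computed from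
`(π_Dstl, r_Dstl)` and the maximum-likelihood reward. -/
def vhatDstl (Pi : Finset (Policy S A)) (c δ : ℝ) (T : ℕ) (D : Dataset S A m)
    (rMLE : Reward S A) (πD : Policy S A) (rD : Reward S A) : ℝ :=
  P.expect πD rD - P.expect P.πref rD - P.β * P.kl πD
    + 1 / P.eta Pi c δ T m * nll D rD - 1 / P.eta Pi c δ T m * nll D rMLE
    - 2 * c * Real.exp (2 * P.R) * √(1 / (m : ℝ) * Real.log (Pi.card * T / δ))

/-- The optimistic estimate of the value gain of the source policy `π*_{r^w}`; it is `+∞` if that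
policy does not occur in the data. -/
def vhatSource {W : ℕ} (Pi : Finset (Policy S A)) (src : Fin W → Reward S A) (δ : ℝ) (T : ℕ)
    (D : Dataset S A m) (rMLE : Reward S A) (w : Fin W) : EReal :=
  if countPolicy D (P.opt (src w)) = 0 then ⊤ else
    ((P.expect (P.opt (src w)) rMLE - P.expect P.πref rMLE - P.β * P.kl (P.opt (src w))
      + 16 * Real.exp (2 * P.R) *
        √(1 / (countPolicy D (P.opt (src w)) : ℝ) * Real.log (Pi.card * W * T / δ)) : ℝ) : EReal)

/-- The intermediate quantities computed in a call of TPS on the dataset `D`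
(the minimisers and maximisers need not be unique). -/
structure IsTPSCall (Pi : Finset (Policy S A)) (c δ : ℝ) (T : ℕ) (D : Dataset S A m)
    (rMLE : Reward S A) (πD : Policy S A) (rD : Reward S A) : Prop where
  mle : P.IsMLE Pi D rMLE
  rpo : P.IsRPO Pi D (P.eta Pi c δ T m) πD rD

/-- `π` is a policy returned by TPS on the dataset `D`: a maximiser of the value estimates among
the source policies and the self-transfer policy. -/
def IsTPSReturn {W : ℕ} (Pi : Finset (Policy S A)) (src : Fin W → Reward S A) (c δ : ℝ) (T : ℕ)
    (D : Dataset S A m) (π : Policy S A) : Prop :=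
  ∃ rMLE πD rD, P.IsTPSCall Pi c δ T D rMLE πD rD ∧
    ((π = πD ∧ ∀ w, P.vhatSource Pi src δ T D rMLE w ≤ (P.vhatDstl Pi c δ T D rMLE πD rD : EReal)) ∨
      ∃ w, π = P.opt (src w) ∧
        (P.vhatDstl Pi c δ T D rMLE πD rD : EReal) ≤ P.vhatSource Pi src δ T D rMLE w ∧
        ∀ w', P.vhatSource Pi src δ T D rMLE w' ≤ P.vhatSource Pi src δ T D rMLE w)

end Problem

section Runs

variable {S A : Type*} [Fintype S] [Fintype A]

/-- A randomised online learning rule: the conditional distribution of the next policy given the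
data it has collected so far. -/
abbrev OnlineRule (S A : Type*) := (j : ℕ) → Kernel (Dataset S A j) (Policy S A)

/-- Given the information `m`, the policy `pol` is drawn from `κ` at the dataset `D`. -/
def SamplesPolicy {Ω : Type*} [MeasurableSpace Ω] (μ : Measure Ω) (m : MeasurableSpace Ω)
    {j : ℕ} (κ : Kernel (Dataset S A j) (Policy S A)) (D : Ω → Dataset S A j)
    (pol : Ω → Policy S A) : Prop :=
  ∀ B : Set (Policy S A), MeasurableSet B →
    μ⟦pol ⁻¹' B | m⟧ =ᵐ[μ] fun ω => (κ (D ω)).real B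

/-- Given the information `m` and the policy `pol`, the observation is drawn as
`s∼ρ`, `a∼pol`, `ã∼π_ref`, `y∼` Bradley--Terry. -/
def SamplesObs (P : Problem S A) {Ω : Type*} [MeasurableSpace Ω] (μ : Measure Ω)
    (m : MeasurableSpace Ω) (pol : Ω → Policy S A) (obs : Ω → Obs S A) : Prop :=
  ∀ x : Obs S A, μ⟦obs ⁻¹' {x} | m ⊔ MeasurableSpace.comap pol inferInstance⟧
    =ᵐ[μ] fun ω => P.obsProb (pol ω) x

/-- The first `Tt` rounds of the process `(pol, obs)` are a run of the rule `κ`. Here `𝓕 j` is the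
information available before round `j` (counted from `0`). -/
structure IsOnlineRun (P : Problem S A) (κ : OnlineRule S A) (Tt : ℕ) {Ω : Type*}
    [mΩ : MeasurableSpace Ω] (μ : Measure Ω) (𝓕 : Filtration ℕ mΩ)
    (pol : ℕ → Ω → Policy S A) (obs : ℕ → Ω → Obs S A) : Prop where
  pol_meas : ∀ j < Tt, Measurable[𝓕 (j + 1)] (pol j)
  obs_meas : ∀ j < Tt, Measurable[𝓕 (j + 1)] (obs j)
  pol_law : ∀ j < Tt, SamplesPolicy μ (𝓕 j) (κ j) (fun ω i => (obs i ω, pol i ω)) (pol j)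
  obs_law : ∀ j < Tt, SamplesObs P μ (𝓕 j) (pol j) (obs j)

/-- `alg Tt δ` is a no-regret online algorithm with policies in `conv Π`: for all `δ ∈ (0,1)` and
every number `Tt` of rounds, with probability at least `1 - δ` its regret after each `t ≤ Tt` rounds
is at most `C_OL R e^{2R} √(C(Π) t log^{c₀}(|Π| Tt/δ))`. -/
structure IsNoRegret {S : Type u} {A : Type v} [Fintype S] [Fintype A]
    (P : Problem S A) (Pi : Finset (Policy S A)) (COL c₀ CPi : ℝ)
    (alg : ℕ → ℝ → OnlineRule S A) : Prop where
  markov : ∀ Tt δ j, IsMarkovKernel (alg Tt δ j)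
  mem : ∀ Tt δ j D, ∀ᵐ π ∂(alg Tt δ j D), π ∈ convexHull ℝ (Pi : Set (Policy S A))
  regret : ∀ (Tt : ℕ) (δ : ℝ), 0 < δ → δ < 1 →
    ∀ (Ω : Type w) [mΩ : MeasurableSpace Ω] (μ : Measure Ω) [IsProbabilityMeasure μ]
      (𝓕 : Filtration ℕ mΩ) (pol : ℕ → Ω → Policy S A) (obs : ℕ → Ω → Obs S A),
      IsOnlineRun P (alg Tt δ) Tt μ 𝓕 pol obs →
      μ {ω | ¬ ∀ t ≤ Tt, ∑ i ∈ Finset.range t, (P.J (P.opt P.rstar) - P.J (pol i ω)) ≤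
        COL * P.R * Real.exp (2 * P.R) *
          √(CPi * t * Real.log (Pi.card * Tt / δ) ^ c₀)} ≤ ENNReal.ofReal δ

/-- In blocks of length `N` whose first `q` rounds are online rounds, the round (counted from `0`)
at which the `j`-th online round takes place. -/
def olTime (N q j : ℕ) : ℕ := j / q * N + j % q

/-- The data `D^{k,n}` collected before round `t`. -/
def dataBefore {Ω : Type*} (pol : ℕ → Ω → Policy S A) (obs : ℕ → Ω → Obs S A) (t : ℕ) (ω : Ω) :
    Dataset S A t := fun i => (obs i ω, pol i ω)

/-- The process `(pol, obs)` is a run of TPO with `K` blocks of `N` iterations. Rounds are counted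
from `0`, so round `t` is iteration `n = t % N + 1` of block `k = t / N + 1`; with `q = ⌊αN⌋` we have
`n ≤ αN` iff `t % N < q`. In the online rounds the policy comes from the online rule called with
horizon `K q`, confidence `δ₀`, and the data of the earlier online rounds; in the other rounds it is
returned by TPS on all data so far. -/
structure IsTPORun (P : Problem S A) (Pi : Finset (Policy S A)) {W : ℕ}
    (src : Fin W → Reward S A) (alg : ℕ → ℝ → OnlineRule S A) (K N : ℕ) (α c δ δ₀ : ℝ)
    {Ω : Type*} [mΩ : MeasurableSpace Ω] (μ : Measure Ω) (𝓕 : Filtration ℕ mΩ)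
    (pol : ℕ → Ω → Policy S A) (obs : ℕ → Ω → Obs S A) : Prop where
  pol_meas : ∀ t < K * N, Measurable[𝓕 (t + 1)] (pol t)
  obs_meas : ∀ t < K * N, Measurable[𝓕 (t + 1)] (obs t)
  online : ∀ j < K * ⌊α * N⌋₊,
    SamplesPolicy μ (𝓕 (olTime N ⌊α * N⌋₊ j)) (alg (K * ⌊α * N⌋₊) δ₀ j)
      (fun ω i => (obs (olTime N ⌊α * N⌋₊ i) ω, pol (olTime N ⌊α * N⌋₊ i) ω))
      (pol (olTime N ⌊α * N⌋₊ j))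
  transfer : ∀ t < K * N, ⌊α * N⌋₊ ≤ t % N →
    ∀ᵐ ω ∂μ, P.IsTPSReturn Pi src c δ (K * N) (dataBefore pol obs t ω) (pol t ω)
  obs_law : ∀ t < K * N, SamplesObs P μ (𝓕 t) (pol t) (obs t)

end Runs

end RLHF

end

/-! The upper bound is pessimism and the lower bound is a max-min argument; both are deterministic
on one good event, so they hold for every choice of minimisers and maximisers at once.

The probabilistic input is Hellinger concentration of log-likelihood ratios. Under the true law, the
mean of `exp` of half the log-likelihood ratio of `r` to `rstar` is one minus a squared Hellinger
distance, so `exp` of the sum of (half log ratio + Hellinger distance) is a supermartingale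
(`integral_exp_sum_le_one`). Markov's inequality and a union bound over the rewards and the prefixes
of the data (`measure_not_concentrates_le`) show that no reward fits the data much better than the
truth, and that a reward far from the truth under the data mixture fits worse
(`Concentrates.nll_sub_le`).

By realizability the class contains `rstar` up to a shift per prompt (`rewardOf_opt`), invisible to
preferences and to value gains over the reference policy. Testing the minimality of the distilled
reward against it gives `vhatDstl_le`; the subtracted term pays for the likelihood advantage of the
maximum-likelihood reward.

For the lower bound, the max-min policy is compared with an arbitrary policy of the hull
(`le_vhatDstl`). Its worst reward can lower its value only by disagreeing with `rstar`; Young's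
inequality splits this loss into a squared error on the data mixture, cancelled by the Hellinger
term, and a term proportional to the coverage. Two comparators are used in `estimate_bounds`. The
optimal policy gives the coverage branch of the minimum. The average of all online policies played
so far gives the other: by concavity of `J` its suboptimality is the average regret, and since
online rounds are roughly an `α` fraction of the data, its coverage is at most `2 / α`. -/

noncomputable section

namespace RLHF

/-! ### Hellinger distance between Bernoulli label laws -/

/-- The Bhattacharyya affinity of the Bernoulli laws with parameters `σ x` and `σ y`. -/
def affinity (x y : ℝ) : ℝ :=
  √(Real.sigmoid x * Real.sigmoid y) + √(Real.sigmoid (-x) * Real.sigmoid (-y))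

lemma affinity_nonneg (x y : ℝ) : 0 ≤ affinity x y := by
  unfold affinity; positivity

lemma one_sub_affinity (x y : ℝ) :
    1 - affinity x y = ((√(Real.sigmoid x) - √(Real.sigmoid y)) ^ 2
      + (√(Real.sigmoid (-x)) - √(Real.sigmoid (-y))) ^ 2) / 2 := by
  have h1 := Real.sq_sqrt (Real.sigmoid_nonneg x)
  have h2 := Real.sq_sqrt (Real.sigmoid_nonneg y)
  have h3 := Real.sq_sqrt (Real.sigmoid_nonneg (-x))
  have h4 := Real.sq_sqrt (Real.sigmoid_nonneg (-y))
  have h5 := Real.sigmoid_neg x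
  have h6 := Real.sigmoid_neg y
  unfold affinity
  rw [Real.sqrt_mul (Real.sigmoid_nonneg x), Real.sqrt_mul (Real.sigmoid_nonneg (-x))]
  nlinarith

lemma one_sub_affinity_nonneg (x y : ℝ) : 0 ≤ 1 - affinity x y := by
  rw [one_sub_affinity]; positivity

lemma sq_sub_le_four_mul_sq_sqrt_sub {p q : ℝ} (hp : 0 ≤ p) (hp1 : p ≤ 1) (hq : 0 ≤ q)
    (hq1 : q ≤ 1) : (p - q) ^ 2 ≤ 4 * (√p - √q) ^ 2 := by
  have h1 : √p ≤ 1 := Real.sqrt_le_one.mpr hp1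
  have h2 : √q ≤ 1 := Real.sqrt_le_one.mpr hq1
  have h3 := Real.sqrt_nonneg p
  have h4 := Real.sqrt_nonneg q
  have h : p - q = (√p + √q) * (√p - √q) := by
    linear_combination -(Real.sq_sqrt hp) + Real.sq_sqrt hq
  rw [h, mul_pow]
  have : (√p + √q) ^ 2 ≤ 4 := by nlinarith
  exact mul_le_mul_of_nonneg_right this (sq_nonneg _)

/-- One of the two factors is at least `1/2`; the other is at least the value of the sigmoid at
`-R`. This bounds the derivative of the sigmoid from below on `[-R, R]`. -/
lemma sigmoid_mul_one_sub_ge {R z : ℝ} (hz : |z| ≤ R) :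
    (2 * (1 + Real.exp R))⁻¹ ≤ Real.sigmoid z * (1 - Real.sigmoid z) := by
  have key : ∀ z : ℝ, 0 ≤ z → z ≤ R →
      (2 * (1 + Real.exp R))⁻¹ ≤ Real.sigmoid z * (1 - Real.sigmoid z) := by
    intro z h0 hz
    have h1 : 2⁻¹ ≤ Real.sigmoid z := by
      rw [← Real.sigmoid_zero]; exact Real.sigmoid_le h0
    have h2 : (1 + Real.exp R)⁻¹ ≤ 1 - Real.sigmoid z := by
      rw [← Real.sigmoid_neg, Real.sigmoid_def, neg_neg]
      gcongr
    rw [mul_inv]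
    exact mul_le_mul h1 h2 (by positivity) (Real.sigmoid_nonneg z)
  rcases le_total 0 z with h | h
  · exact key z h ((le_abs_self z).trans hz)
  · have := key (-z) (by linarith) ((neg_le_abs z).trans hz)
    rw [Real.sigmoid_neg] at this
    linarith

lemma sigmoid_sub_ge {R x y : ℝ} (hx : |x| ≤ R) (hy : |y| ≤ R) (hxy : x ≤ y) :
    (2 * (1 + Real.exp R))⁻¹ * (y - x) ≤ Real.sigmoid y - Real.sigmoid x := by
  rw [abs_le] at hx hy
  refine (convex_Icc (-R) R).mul_sub_le_image_sub_of_le_deriv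
    (differentiable_sigmoid.continuous.continuousOn)
    (differentiable_sigmoid.differentiableOn) ?_ x hx y hy hxy
  intro z hz
  rw [Real.deriv_sigmoid]
  exact sigmoid_mul_one_sub_ge (abs_le.mpr (Set.mem_Icc.mp (interior_subset hz)))

/-- Turns Hellinger distance into squared reward error. The constant is `16 = 4 * 4`: one factor
from the slope `1 / (2 (1 + e^R))` squared, one from passing from probabilities to their square
roots. The two labels contribute equally, which offsets the division by `2` in `one_sub_affinity`.
-/
lemma sq_sub_div_le_one_sub_affinity {R x y : ℝ} (hx : |x| ≤ R) (hy : |y| ≤ R) :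
    (x - y) ^ 2 / (16 * (1 + Real.exp R) ^ 2) ≤ 1 - affinity x y := by
  have h1 : (x - y) ^ 2 / (4 * (1 + Real.exp R) ^ 2)
      ≤ (Real.sigmoid x - Real.sigmoid y) ^ 2 := by
    have e : (x - y) ^ 2 / (4 * (1 + Real.exp R) ^ 2)
        = ((2 * (1 + Real.exp R))⁻¹ * (x - y)) ^ 2 := by
      field_simp; ring
    rw [e, sq_le_sq, abs_mul, abs_of_pos (a := (2 * (1 + Real.exp R))⁻¹) (by positivity)]
    rcases le_total x y with h | h
    · have := sigmoid_sub_ge hx hy h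
      have h' := Real.sigmoid_le h
      rw [abs_sub_comm, abs_of_nonneg (sub_nonneg.mpr h), abs_sub_comm,
        abs_of_nonneg (sub_nonneg.mpr h')]
      exact this
    · have := sigmoid_sub_ge hy hx h
      have h' := Real.sigmoid_le h
      rw [abs_of_nonneg (sub_nonneg.mpr h), abs_of_nonneg (sub_nonneg.mpr h')]
      exact this
  have h2 := sq_sub_le_four_mul_sq_sqrt_sub (Real.sigmoid_nonneg x) (Real.sigmoid_le_one x)
    (Real.sigmoid_nonneg y) (Real.sigmoid_le_one y)
  have h3 := sq_sub_le_four_mul_sq_sqrt_sub (Real.sigmoid_nonneg (-x)) (Real.sigmoid_le_one (-x))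
    (Real.sigmoid_nonneg (-y)) (Real.sigmoid_le_one (-y))
  rw [Real.sigmoid_neg, Real.sigmoid_neg] at h3
  have e : (x - y) ^ 2 / (16 * (1 + Real.exp R) ^ 2)
      = (x - y) ^ 2 / (4 * (1 + Real.exp R) ^ 2) / 4 := by
    field_simp; ring
  rw [one_sub_affinity, e, Real.sigmoid_neg, Real.sigmoid_neg]
  nlinarith

/-! ### Likelihoods in the Bradley–Terry model -/

section Lik

variable {S A : Type*}

/-- Likelihood of the label of an observation under the Bradley--Terry model with reward `r`. -/
def lik (r : Reward S A) (x : Obs S A) : ℝ :=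
  if x.y then Real.sigmoid (r x.s x.a - r x.s x.b) else Real.sigmoid (r x.s x.b - r x.s x.a)

lemma lik_pos (r : Reward S A) (x : Obs S A) : 0 < lik r x := by
  unfold lik; split_ifs <;> exact Real.sigmoid_pos _

/-- Half of the log-likelihood ratio of the rewards `r` and `r'`. -/
def halfLogRatio (r r' : Reward S A) (x : Obs S A) : ℝ :=
  (Real.log (lik r x) - Real.log (lik r' x)) / 2

lemma nll_eq {m : ℕ} (D : Dataset S A m) (r : Reward S A) :
    nll D r = -((1 / (m : ℝ)) * ∑ i, Real.log (lik r (D i).1)) := by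
  unfold nll lik
  rw [← mul_neg, ← Finset.sum_neg_distrib]
  congr 1
  refine Finset.sum_congr rfl fun i _ => ?_
  split_ifs <;> rfl

lemma lik_congr {r r' : Reward S A} {g : S → ℝ} (h : ∀ s a, r s a = r' s a - g s) :
    lik r = lik r' := by
  funext x
  simp [lik, h]

/-- Decomposition of an observation into its components. -/
def obsEquiv (S A : Type*) : Obs S A ≃ S × A × A × Bool where
  toFun x := (x.s, x.a, x.b, x.y)
  invFun p := ⟨p.1, p.2.1, p.2.2.1, p.2.2.2⟩
  left_inv _ := rfl
  right_inv _ := rfl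

instance [Fintype S] [Fintype A] : Fintype (Obs S A) := Fintype.ofEquiv _ (obsEquiv S A).symm

lemma sum_obs [Fintype S] [Fintype A] (F : Obs S A → ℝ) :
    ∑ x, F x = ∑ s, ∑ a, ∑ b, (F ⟨s, a, b, true⟩ + F ⟨s, a, b, false⟩) := by
  rw [← (obsEquiv S A).symm.sum_comp]
  simp only [Fintype.sum_prod_type, Fintype.sum_bool]
  rfl

/-- Tilting by half the log ratio produces the geometric mean of the two likelihoods; summed over
the labels this is the affinity. -/
lemma sqrt_mul_eq_mul_exp {p q : ℝ} (hp : 0 < p) (hq : 0 < q) :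
    q * Real.exp ((Real.log p - Real.log q) / 2) = √(p * q) := by
  have h : p * q = (q * Real.exp ((Real.log p - Real.log q) / 2)) ^ 2 := by
    have e : ((2 : ℕ) : ℝ) * ((Real.log p - Real.log q) / 2) = Real.log p - Real.log q := by
      push_cast; ring
    rw [mul_pow, ← Real.exp_nat_mul, e, Real.exp_sub, Real.exp_log hp, Real.exp_log hq]
    field_simp
  rw [h, Real.sqrt_sq (by positivity)]

end Lik

/-! ### Expected Hellinger distance and the one-step exponential moment -/

namespace Problem

variable {S A : Type*} [Fintype S] [Fintype A] (P : Problem S A)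

/-- `E_{s∼ρ, a∼π, b∼π_ref}[f(s,a,b)]`. -/
def pairExpect (π : Policy S A) (f : S → A → A → ℝ) : ℝ :=
  ∑ s, P.ρ s * ∑ a, π s a * ∑ b, P.πref s b * f s a b

/-- Expected squared Hellinger distance between the label laws of `r` and of the true reward. -/
def hell (r : Reward S A) (π : Policy S A) : ℝ :=
  P.pairExpect π fun s a b => 1 - affinity (r s a - r s b) (P.rstar s a - P.rstar s b)

lemma ρ_nonneg (s : S) : 0 ≤ P.ρ s := P.ρ_mem.1 s

lemma pairExpect_mono {π : Policy S A} (hπ : ∀ s a, 0 ≤ π s a) {f g : S → A → A → ℝ}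
    (h : ∀ s a b, f s a b ≤ g s a b) : P.pairExpect π f ≤ P.pairExpect π g := by
  unfold pairExpect
  gcongr with s _ a _ b _
  · exact P.ρ_nonneg s
  · exact hπ s a
  · exact (P.πref_pos s b).le
  · exact h s a b

lemma pairExpect_const {π : Policy S A} (hπ : IsPolicy π) (k : ℝ) :
    P.pairExpect π (fun _ _ _ => k) = k := by
  simp only [pairExpect, ← Finset.sum_mul, (P.πref_policy _).2, (hπ _).2, P.ρ_mem.2, one_mul]

lemma pairExpect_sub (π : Policy S A) (f g : S → A → A → ℝ) :
    P.pairExpect π (fun s a b => f s a b - g s a b) = P.pairExpect π f - P.pairExpect π g := by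
  simp only [pairExpect, mul_sub, Finset.sum_sub_distrib]

lemma pairExpect_left {π : Policy S A} (f : S → A → ℝ) :
    P.pairExpect π (fun s a _ => f s a) = P.expect π f := by
  simp only [pairExpect, expect, ← Finset.sum_mul, (P.πref_policy _).2, one_mul]

lemma pairExpect_right {π : Policy S A} (hπ : IsPolicy π) (f : S → A → ℝ) :
    P.pairExpect π (fun s _ b => f s b) = P.expect P.πref f := by
  simp only [pairExpect, expect, ← Finset.sum_mul, (hπ _).2, one_mul]

lemma hell_nonneg (r : Reward S A) {π : Policy S A} (hπ : IsPolicy π) : 0 ≤ P.hell r π := by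
  have := P.pairExpect_mono (π := π) (fun s a => (hπ s).1 a) (f := fun _ _ _ => 0)
    (g := fun s a b => 1 - affinity (r s a - r s b) (P.rstar s a - P.rstar s b))
    fun s a b => one_sub_affinity_nonneg _ _
  rwa [pairExpect_const P hπ] at this

lemma hell_le_one (r : Reward S A) {π : Policy S A} (hπ : IsPolicy π) : P.hell r π ≤ 1 := by
  have := P.pairExpect_mono (π := π) (fun s a => (hπ s).1 a) (g := fun _ _ _ => 1)
    (f := fun s a b => 1 - affinity (r s a - r s b) (P.rstar s a - P.rstar s b))
    fun s a b => by linarith [affinity_nonneg (r s a - r s b) (P.rstar s a - P.rstar s b)]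
  rwa [pairExpect_const P hπ] at this

lemma obsProb_eq (π : Policy S A) (x : Obs S A) :
    P.obsProb π x = P.ρ x.s * π x.s x.a * P.πref x.s x.b * lik P.rstar x := rfl

lemma sum_obsProb_mul_exp (r : Reward S A) (π : Policy S A) :
    ∑ x, P.obsProb π x * Real.exp (halfLogRatio r P.rstar x)
      = P.pairExpect π fun s a b =>
        affinity (r s a - r s b) (P.rstar s a - P.rstar s b) := by
  have h : ∀ x, P.obsProb π x * Real.exp (halfLogRatio r P.rstar x)
      = P.ρ x.s * π x.s x.a * P.πref x.s x.b * √(lik r x * lik P.rstar x) := by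
    intro x
    rw [obsProb_eq, mul_assoc _ (lik _ _), halfLogRatio,
      sqrt_mul_eq_mul_exp (lik_pos _ _) (lik_pos _ _)]
  simp only [h, sum_obs, pairExpect, Finset.mul_sum]
  refine Finset.sum_congr rfl fun s _ => Finset.sum_congr rfl fun a _ =>
    Finset.sum_congr rfl fun b _ => ?_
  simp only [lik, affinity, neg_sub, if_true, Bool.false_eq_true, if_false]
  ring

/-- The left side is exactly `1 - hell`, and `1 - x ≤ exp (-x)`. This is the supermartingale
increment. -/
lemma sum_obsProb_mul_exp_le (r : Reward S A) {π : Policy S A} (hπ : IsPolicy π) :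
    ∑ x, P.obsProb π x * Real.exp (halfLogRatio r P.rstar x) ≤ Real.exp (-P.hell r π) := by
  have h : ∑ x, P.obsProb π x * Real.exp (halfLogRatio r P.rstar x) = 1 - P.hell r π := by
    rw [sum_obsProb_mul_exp, hell, pairExpect_sub, pairExpect_const P hπ]; ring
  rw [h]
  linarith [Real.add_one_le_exp (-P.hell r π)]

end Problem

/-! ### Realizability, concavity of the value, and coverage -/

namespace Problem

variable {S A : Type*} [Fintype S] [Fintype A] (P : Problem S A)

lemma nonempty_prompt (P : Problem S A) : Nonempty S := by
  by_contra h
  rw [not_nonempty_iff] at h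
  have := P.ρ_mem.2
  simp at this

lemma nonempty_response (P : Problem S A) : Nonempty A := by
  obtain ⟨s⟩ := P.nonempty_prompt
  by_contra h
  rw [not_nonempty_iff] at h
  have := (P.πref_policy s).2
  simp at this

lemma R_nonneg : 0 ≤ P.R := by
  obtain ⟨s⟩ := P.nonempty_prompt
  obtain ⟨a⟩ := P.nonempty_response
  exact (P.rstar_mem s a).1.trans (P.rstar_mem s a).2

lemma opt_pos (r : Reward S A) (s : S) (a : A) : 0 < P.opt r s a := by
  have := P.nonempty_response
  unfold opt
  have h : ∀ b, 0 < P.πref s b * Real.exp (r s b / P.β) := fun b =>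
    mul_pos (P.πref_pos s b) (Real.exp_pos _)
  exact div_pos (h a) (Finset.sum_pos (fun b _ => h b) Finset.univ_nonempty)

lemma opt_policy (r : Reward S A) : IsPolicy (P.opt r) := by
  intro s
  have := P.nonempty_response
  refine ⟨fun a => (P.opt_pos r s a).le, ?_⟩
  have h : ∀ b, 0 < P.πref s b * Real.exp (r s b / P.β) := fun b =>
    mul_pos (P.πref_pos s b) (Real.exp_pos _)
  unfold opt
  rw [← Finset.sum_div]
  exact div_self (Finset.sum_pos (fun b _ => h b) Finset.univ_nonempty).ne'

lemma rewardOf_mem (π : Policy S A) (s : S) (a : A) : P.rewardOf π s a ∈ Set.Icc 0 P.R :=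
  ⟨le_max_left _ _, max_le P.R_nonneg (min_le_left _ _)⟩

lemma abs_sub_le_of_mem_rewardClass {Pi : Finset (Policy S A)} {r : Reward S A}
    (hr : r ∈ P.rewardClass Pi) (s : S) (a b : A) : |r s a - r s b| ≤ P.R := by
  obtain ⟨π, -, rfl⟩ := hr
  have h1 := P.rewardOf_mem π s a
  have h2 := P.rewardOf_mem π s b
  rw [abs_le]
  constructor <;> linarith [h1.1, h1.2, h2.1, h2.2]

lemma abs_rstar_sub_le (s : S) (a b : A) : |P.rstar s a - P.rstar s b| ≤ P.R := by
  have h1 := P.rstar_mem s a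
  have h2 := P.rstar_mem s b
  rw [abs_le]
  constructor <;> linarith [h1.1, h1.2, h2.1, h2.2]

/-- The reward induced by the optimal policy is the true reward up to a shift per prompt. -/
lemma rewardOf_opt : ∃ g : S → ℝ, ∀ s a, P.rewardOf (P.opt P.rstar) s a = P.rstar s a - g s := by
  have := P.nonempty_response
  have hβ := P.β_pos
  refine ⟨fun s => ⨅ a, P.rstar s a, fun s a => ?_⟩
  set Z := ∑ b, P.πref s b * Real.exp (P.rstar s b / P.β) with hZ
  have hZpos : 0 < Z := Finset.sum_pos (fun b _ => mul_pos (P.πref_pos s b) (Real.exp_pos _))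
    Finset.univ_nonempty
  have hlog : ∀ b, P.β * Real.log (P.opt P.rstar s b / P.πref s b)
      = P.rstar s b - P.β * Real.log Z := by
    intro b
    have e : P.opt P.rstar s b / P.πref s b = Real.exp (P.rstar s b / P.β) / Z := by
      have := (P.πref_pos s b).ne'
      unfold opt
      rw [← hZ]
      field_simp
    rw [e, Real.log_div (Real.exp_pos _).ne' hZpos.ne', Real.log_exp]
    field_simp
  have hbdd : BddBelow (Set.range fun b => P.rstar s b) := (Set.finite_range _).bddBelow
  have hinf : ⨅ b, P.β * Real.log (P.opt P.rstar s b / P.πref s b)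
      = (⨅ b, P.rstar s b) - P.β * Real.log Z := by
    simp only [hlog]
    rw [ciInf_sub hbdd]
  have h1 : ⨅ b, P.rstar s b ≤ P.rstar s a := ciInf_le hbdd a
  have h2 : 0 ≤ ⨅ b, P.rstar s b := le_ciInf fun b => (P.rstar_mem s b).1
  -- The normaliser `β log Z` cancels against the same term in the minimum, and the clipping is
  -- inactive because `rstar` takes values in `[0, R]`.
  unfold rewardOf
  rw [hinf, hlog, sub_sub_sub_cancel_right, min_eq_right (by linarith [(P.rstar_mem s a).2]),
    max_eq_right (by linarith)]

variable {P} in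
lemma GoodClass.policy_pos_of_mem_convexHull {Pi : Finset (Policy S A)} (h : P.GoodClass Pi)
    {π : Policy S A} (hπ : π ∈ convexHull ℝ (Pi : Set (Policy S A))) :
    IsPolicy π ∧ ∀ s a, 0 < π s a := by
  let G : Set (Policy S A) := {π | IsPolicy π ∧ ∀ s a, 0 < π s a}
  have hG : Convex ℝ G := by
    intro p hp q hq x y hx hy hxy
    refine ⟨fun s => convex_stdSimplex ℝ A (hp.1 s) (hq.1 s) hx hy hxy, fun s a => ?_⟩
    have h1 := hp.2 s a
    have h2 := hq.2 s a
    change 0 < x * p s a + y * q s a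
    rcases hx.eq_or_lt with rfl | hx
    · have : y = 1 := by linarith
      subst this; linarith
    · have := mul_pos hx h1
      have := mul_nonneg hy h2.le
      linarith
  have hsub : (Pi : Set (Policy S A)) ⊆ G := fun p hp => ⟨h.policy p hp, h.pos p hp⟩
  exact convexHull_min hsub hG hπ

lemma J_πref : P.J P.πref = P.expect P.πref P.rstar := by
  have : ∀ s a, P.πref s a / P.πref s a = 1 := fun s a => div_self (P.πref_pos s a).ne'
  simp [J, kl, expect, this]

lemma expect_sub_expect_πref {π : Policy S A} (hπ : IsPolicy π) (r : Reward S A) :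
    P.expect π r - P.expect P.πref r = P.pairExpect π fun s a b => r s a - r s b := by
  rw [pairExpect_sub, pairExpect_left, pairExpect_right P hπ]

/-- The reward part is linear, and the KL part reduces to the convex function `x log x` plus a
linear term. The domain allows zero probabilities, where the convention `0 * log 0 = 0` is used. -/
lemma concaveOn_J : ConcaveOn ℝ {π : Policy S A | ∀ s a, 0 ≤ π s a} P.J := by
  have hconv : Convex ℝ {π : Policy S A | ∀ s a, 0 ≤ π s a} := by
    intro p hp q hq x y hx hy _ s a
    have := mul_nonneg hx (hp s a)
    have := mul_nonneg hy (hq s a)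
    simp only [Pi.add_apply, Pi.smul_apply, smul_eq_mul]
    linarith
  refine ⟨hconv, fun p hp q hq x y hx hy hxy => ?_⟩
  have key : ∀ π : Policy S A, P.J π = ∑ s, P.ρ s * ∑ a,
      (π s a * P.rstar s a - P.β * (π s a * Real.log (π s a / P.πref s a))) := by
    intro π
    simp only [J, kl, expect, Finset.sum_sub_distrib, mul_sub, Finset.mul_sum]
    congr 1
    refine Finset.sum_congr rfl fun s _ => Finset.sum_congr rfl fun a _ => by ring
  have hlog : ∀ (z : ℝ) s a, z * Real.log (z / P.πref s a)
      = z * Real.log z - z * Real.log (P.πref s a) := by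
    intro z s a
    rcases eq_or_ne z 0 with rfl | hz
    · simp
    · rw [Real.log_div hz (P.πref_pos s a).ne', mul_sub]
  simp only [key, smul_eq_mul, Finset.mul_sum]
  rw [← Finset.sum_add_distrib]
  refine Finset.sum_le_sum fun s _ => ?_
  rw [← Finset.sum_add_distrib]
  refine Finset.sum_le_sum fun a _ => ?_
  have h := Real.convexOn_mul_log.2 (hp s a) (hq s a) hx hy hxy
  simp only [smul_eq_mul] at h
  simp only [hlog, Pi.add_apply, Pi.smul_apply, smul_eq_mul]
  have h' := mul_le_mul_of_nonneg_left h P.β_pos.le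
  have h'' := mul_le_mul_of_nonneg_left h' (P.ρ_nonneg s)
  linarith

/-- The coverage is one plus a chi-square divergence. It lets coverage-free errors be absorbed into
the coverage term. -/
lemma one_le_cov {π' π : Policy S A} (hπ' : IsPolicy π') (hπ : IsPolicy π)
    (hpos : ∀ s a, 0 < π s a) : 1 ≤ P.cov π' π := by
  have h : ∀ s, 1 ≤ ∑ a, π' s a * (π' s a / π s a) := by
    intro s
    have e : (1 : ℝ) = ∑ a, (2 * π' s a - π s a) := by
      rw [Finset.sum_sub_distrib, ← Finset.mul_sum, (hπ' s).2, (hπ s).2]; norm_num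
    rw [e]
    refine Finset.sum_le_sum fun a _ => ?_
    rw [← mul_div_assoc, le_div_iff₀ (hpos s a)]
    nlinarith [sq_nonneg (π' s a - π s a)]
  calc (1 : ℝ) = ∑ s, P.ρ s * 1 := by simp [P.ρ_mem.2]
    _ ≤ P.cov π' π := Finset.sum_le_sum fun s _ => mul_le_mul_of_nonneg_left (h s) (P.ρ_nonneg s)

lemma cov_nonneg {π' π : Policy S A} (hπ' : ∀ s a, 0 ≤ π' s a) (hπ : ∀ s a, 0 ≤ π s a) :
    0 ≤ P.cov π' π :=
  Finset.sum_nonneg fun s _ => mul_nonneg (P.ρ_nonneg s) <| Finset.sum_nonneg fun a _ =>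
    mul_nonneg (hπ' s a) (div_nonneg (hπ' s a) (hπ s a))

lemma cov_le_of_le_mul {π' π : Policy S A} (hπ' : IsPolicy π') (hpos : ∀ s a, 0 < π s a) {k : ℝ}
    (h : ∀ s a, π' s a ≤ k * π s a) : P.cov π' π ≤ k := by
  calc P.cov π' π ≤ ∑ s, P.ρ s * ∑ a, π' s a * k := by
        unfold cov expect
        gcongr with s _ a _
        · exact P.ρ_nonneg s
        · exact (hπ' s).1 a
        · exact (div_le_iff₀ (hpos s a)).mpr (h s a)
    _ = k := by simp [← Finset.sum_mul, (hπ' _).2, P.ρ_mem.2]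

/-- Change of measure by Young's inequality. -/
lemma pairExpect_le_cov {π' π : Policy S A} (hπ : ∀ s a, 0 < π s a)
    (d : S → A → A → ℝ) {k : ℝ} (hk : 0 < k) :
    P.pairExpect π' d ≤ k * P.pairExpect π (fun s a b => d s a b ^ 2) + P.cov π' π / (4 * k) := by
  have e : k * P.pairExpect π (fun s a b => d s a b ^ 2) + P.cov π' π / (4 * k)
      = ∑ s, P.ρ s * ∑ a, ∑ b, P.πref s b *
        (k * (π s a * d s a b ^ 2) + π' s a * (π' s a / π s a) / (4 * k)) := by
    simp only [cov, ← pairExpect_left P, pairExpect, mul_add, Finset.sum_add_distrib,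
      Finset.mul_sum, Finset.sum_div]
    congr 1 <;>
    exact Finset.sum_congr rfl fun s _ => Finset.sum_congr rfl fun a _ =>
      Finset.sum_congr rfl fun b _ => by ring
  rw [e]
  unfold pairExpect
  refine Finset.sum_le_sum fun s _ => mul_le_mul_of_nonneg_left ?_ (P.ρ_nonneg s)
  refine Finset.sum_le_sum fun a _ => ?_
  rw [Finset.mul_sum]
  refine Finset.sum_le_sum fun b _ => ?_
  rw [mul_left_comm]
  refine mul_le_mul_of_nonneg_left ?_ (P.πref_pos s b).le
  have hp := hπ s a
  have : k * (π s a * d s a b ^ 2) + π' s a * (π' s a / π s a) / (4 * k) - π' s a * d s a b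
      = (2 * k * π s a * d s a b - π' s a) ^ 2 / (4 * k * π s a) := by
    field_simp; ring
  have h2 : 0 ≤ (2 * k * π s a * d s a b - π' s a) ^ 2 / (4 * k * π s a) := by positivity
  linarith

/-! ### Data mixtures and the concentration event -/

variable {m : ℕ}

lemma hell_mixture (r : Reward S A) (D : Dataset S A m) :
    P.hell r (mixture D) = (1 / (m : ℝ)) * ∑ i, P.hell r (D i).2 := by
  simp only [hell, pairExpect]
  rw [Finset.sum_comm, Finset.mul_sum]
  refine Finset.sum_congr rfl fun s _ => ?_
  rw [← Finset.mul_sum, Finset.sum_comm, mul_left_comm]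
  congr 1
  rw [Finset.mul_sum]
  refine Finset.sum_congr rfl fun a _ => ?_
  rw [mixture, ← Finset.sum_mul, mul_assoc]

omit [Fintype S] in
lemma mixture_policy {D : Dataset S A m} (hm : 0 < m) (h : ∀ i, IsPolicy (D i).2) :
    IsPolicy (mixture D) := by
  have hm' : (m : ℝ) ≠ 0 := by positivity
  refine fun s => ⟨fun a => ?_, ?_⟩
  · exact mul_nonneg (by positivity) (Finset.sum_nonneg fun i _ => (h i s).1 a)
  · unfold mixture
    rw [← Finset.mul_sum, Finset.sum_comm]
    simp [(h _ s).2, hm']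

omit [Fintype S] [Fintype A] in
lemma mixture_pos {D : Dataset S A m} (hm : 0 < m) (h : ∀ i s a, 0 < (D i).2 s a) (s : S)
    (a : A) : 0 < mixture D s a := by
  have : Nonempty (Fin m) := ⟨⟨0, hm⟩⟩
  exact mul_pos (by positivity) (Finset.sum_pos (fun i _ => h i s a) Finset.univ_nonempty)

/-- The event on which the likelihood ratios concentrate. -/
def Concentrates (Pi : Finset (Policy S A)) (D : Dataset S A m) (l : ℝ) : Prop :=
  ∀ r ∈ P.rewardClass Pi, ∑ i, (halfLogRatio r P.rstar (D i).1 + P.hell r (D i).2) ≤ 2 * l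

variable {P}

/-- The concentration inequality multiplied by `2 / m`; since `hell` is linear in the policy, the
average over the data is its value at the mixture. -/
lemma Concentrates.nll_sub_le {Pi : Finset (Policy S A)} {D : Dataset S A m} {l : ℝ}
    (h : P.Concentrates Pi D l) {r : Reward S A} (hr : r ∈ P.rewardClass Pi) :
    nll D P.rstar - nll D r ≤ 4 * (1 / (m : ℝ) * l) - 2 * P.hell r (mixture D) := by
  have h1 := mul_le_mul_of_nonneg_left (h r hr) (a := 2 * (1 / (m : ℝ))) (by positivity)
  rw [hell_mixture, nll_eq, nll_eq]
  simp only [Finset.sum_add_distrib, halfLogRatio, ← Finset.sum_div, Finset.sum_sub_distrib] at h1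
  linarith

lemma exists_rewardClass_shift {Pi : Finset (Policy S A)} (hG : P.GoodClass Pi) :
    ∃ r ∈ P.rewardClass Pi, (∃ g : S → ℝ, ∀ s a, r s a = P.rstar s a - g s) ∧
      ∀ D : Dataset S A m, nll D r = nll D P.rstar := by
  obtain ⟨g, hg⟩ := P.rewardOf_opt
  refine ⟨_, ⟨_, hG.realizable, rfl⟩, ⟨g, hg⟩, fun D => ?_⟩
  rw [nll_eq, nll_eq, lik_congr hg]

/-! ### Deterministic bounds on the self-transfer estimate -/

section Estimate

variable {Pi : Finset (Policy S A)} {D : Dataset S A m} {c δ : ℝ} {T : ℕ}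
  {rMLE rD : Reward S A} {πD : Policy S A}

lemma nll_mle_le (hG : P.GoodClass Pi) (h : P.IsMLE Pi D rMLE) : nll D rMLE ≤ nll D P.rstar := by
  obtain ⟨r, hr, -, hn⟩ := exists_rewardClass_shift (m := m) hG
  rw [← hn D]
  exact h.2 hr

lemma one_add_exp_sq_le (P : Problem S A) : (1 + Real.exp P.R) ^ 2 ≤ 4 * Real.exp (2 * P.R) := by
  have h1 : 1 ≤ Real.exp P.R := Real.one_le_exp P.R_nonneg
  have h2 : Real.exp (2 * P.R) = Real.exp P.R ^ 2 := by rw [← Real.exp_nat_mul]; norm_num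
  rw [h2]; nlinarith

/-- The self-transfer estimate is pessimistic. -/
lemma vhatDstl_le (hc : √24 ≤ c) (hG : P.GoodClass Pi) (hm : 0 < m)
    (hl : 0 < Real.log (Pi.card * T / δ))
    (hconc : P.Concentrates Pi D (Real.log (Pi.card * T / δ)))
    (hD : ∀ i, IsPolicy (D i).2)
    (hcall : P.IsTPSCall Pi c δ T D rMLE πD rD) :
    P.vhatDstl Pi c δ T D rMLE πD rD ≤ P.J πD - P.J P.πref := by
  set l := Real.log (Pi.card * T / δ) with hl'
  set x := 1 / (m : ℝ) * l with hx
  have hxpos : 0 < x := by positivity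
  have hu : 0 < √x := Real.sqrt_pos.mpr hxpos
  have hux : √x ^ 2 = x := Real.sq_sqrt hxpos.le
  have hc0 : 0 < c := lt_of_lt_of_le (by positivity) hc
  have hc2 : 24 ≤ c ^ 2 := by
    have := Real.sq_sqrt (show (0 : ℝ) ≤ 24 by norm_num)
    have := pow_le_pow_left₀ (Real.sqrt_nonneg 24) hc 2
    linarith
  have hη : P.eta Pi c δ T m = c * ((1 + Real.exp P.R) ^ 2)⁻¹ * √x := by rw [eta, ← hl']
  have hηpos : 0 < P.eta Pi c δ T m := by rw [hη]; positivity
  obtain ⟨r, hr, ⟨g, hg⟩, hn⟩ := exists_rewardClass_shift (m := m) hG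
  have hπD := (hG.policy_pos_of_mem_convexHull hcall.rpo.mem).1
  have hmin : P.rpoObj D (P.eta Pi c δ T m) πD rD ≤ P.rpoObj D (P.eta Pi c δ T m) πD r :=
    hcall.rpo.min hr
  have hr' : P.expect πD r - P.expect P.πref r = P.expect πD P.rstar - P.expect P.πref P.rstar := by
    rw [expect_sub_expect_πref P hπD, expect_sub_expect_πref P hπD]
    simp only [hg, sub_sub_sub_cancel_right]
  have hh := hconc.nll_sub_le hcall.mle.1
  have hh2 := P.hell_nonneg rMLE (mixture_policy hm hD)
  have hh3 : nll D P.rstar - nll D rMLE ≤ 4 * x := by linarith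
  unfold rpoObj at hmin
  rw [hr', hn D] at hmin
  have hmin' := mul_le_mul_of_nonneg_left hmin (a := 1 / P.eta Pi c δ T m) (by positivity)
  have hcancel : ∀ z, 1 / P.eta Pi c δ T m * (P.eta Pi c δ T m * z) = z := fun z => by field_simp
  rw [mul_add, mul_add, hcancel, hcancel] at hmin'
  -- The likelihood gap is of order `x` and `η` of order `√x`, so the quotient is of order `√x`.
  -- After `(1 + e^R)² ≤ 4 e^{2R}` it remains to see `16 / c ≤ 2 c`, which follows from `c² ≥ 24`.
  have hb : 1 / P.eta Pi c δ T m * (nll D P.rstar - nll D rMLE)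
      ≤ 2 * c * Real.exp (2 * P.R) * √x := by
    calc _ ≤ 1 / P.eta Pi c δ T m * (4 * x) := mul_le_mul_of_nonneg_left hh3 (by positivity)
      _ = 4 * (1 + Real.exp P.R) ^ 2 * √x / c := by
        rw [hη]; nth_rewrite 2 [← hux]; field_simp
      _ ≤ 4 * (4 * Real.exp (2 * P.R)) * √x / c := by gcongr; exact P.one_add_exp_sq_le
      _ ≤ 2 * c * Real.exp (2 * P.R) * √x := by
        rw [div_le_iff₀ hc0]
        have : 0 < Real.exp (2 * P.R) * √x := by positivity
        nlinarith
  unfold vhatDstl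
  rw [← hl', ← hx, J_πref, J]
  linarith

/-- The self-transfer estimate competes with every policy of the convex hull, up to its coverage. -/
lemma le_vhatDstl (hc : √24 ≤ c) (hG : P.GoodClass Pi) (hm : 0 < m)
    (hl : 0 < Real.log (Pi.card * T / δ))
    (hconc : P.Concentrates Pi D (Real.log (Pi.card * T / δ)))
    (hD : ∀ i, IsPolicy (D i).2) (hpos : ∀ i s a, 0 < (D i).2 s a)
    (hcall : P.IsTPSCall Pi c δ T D rMLE πD rD) {π : Policy S A}
    (hπ : π ∈ convexHull ℝ (Pi : Set (Policy S A))) :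
    P.J π - P.J P.πref - 5 * c * Real.exp (2 * P.R) * P.cov π (mixture D) *
        √(1 / (m : ℝ) * Real.log (Pi.card * T / δ))
      ≤ P.vhatDstl Pi c δ T D rMLE πD rD := by
  set l := Real.log (Pi.card * T / δ) with hl'
  set x := 1 / (m : ℝ) * l with hx
  have hxpos : 0 < x := by positivity
  have hu : 0 < √x := Real.sqrt_pos.mpr hxpos
  have hux : √x ^ 2 = x := Real.sq_sqrt hxpos.le
  have hc0 : 0 < c := lt_of_lt_of_le (by positivity) hc
  have hc2 : 24 ≤ c ^ 2 := by
    have := Real.sq_sqrt (show (0 : ℝ) ≤ 24 by norm_num)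
    have := pow_le_pow_left₀ (Real.sqrt_nonneg 24) hc 2
    linarith
  have hη : P.eta Pi c δ T m = c * ((1 + Real.exp P.R) ^ 2)⁻¹ * √x := by rw [eta, ← hl']
  set η := P.eta Pi c δ T m with hη'
  have hηpos : 0 < η := by rw [hη]; positivity
  have hπp := (hG.policy_pos_of_mem_convexHull hπ).1
  have hmix := mixture_policy hm hD
  have hmixpos := mixture_pos hm hpos
  have hfin : (P.rewardClass Pi).Finite := Pi.finite_toSet.image _
  have hne : (P.rewardClass Pi).Nonempty := ⟨_, ⟨_, hG.realizable, rfl⟩⟩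
  -- The class is finite, so the inner infimum at the comparator is attained: `r` is the worst
  -- reward for `π`.
  obtain ⟨r, hr, hrmin⟩ := (hne.image (P.rpoObj D η π)).csInf_mem (hfin.image _)
  have hmax : P.rpoObj D η π r ≤ P.rpoObj D η πD rD := by
    rw [hrmin]
    refine (hcall.rpo.max hπ).trans ?_
    exact csInf_le (hfin.image _).bddBelow ⟨rD, hcall.rpo.mem_reward, rfl⟩
  have hnll := hconc.nll_sub_le hr
  have hmle := nll_mle_le hG hcall.mle
  set d : S → A → A → ℝ := fun s a b => (P.rstar s a - P.rstar s b) - (r s a - r s b) with hd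
  -- This `k` makes Young's quadratic term cancel the Hellinger term exactly: `(1 / η) * 2 / (16 (1
  -- + e^R)²) = 1 / (8 c √x)`.
  have hcov := P.pairExpect_le_cov (π' := π) hmixpos d (k := 1 / (8 * c * √x)) (by positivity)
  have hhell : P.pairExpect (mixture D) (fun s a b => d s a b ^ 2) / (16 * (1 + Real.exp P.R) ^ 2)
      ≤ P.hell r (mixture D) := by
    have : P.pairExpect (mixture D) (fun s a b => d s a b ^ 2) / (16 * (1 + Real.exp P.R) ^ 2)
        = P.pairExpect (mixture D) (fun s a b => d s a b ^ 2 / (16 * (1 + Real.exp P.R) ^ 2)) := by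
      simp only [pairExpect, Finset.sum_div, mul_div_assoc]
    rw [this]
    refine P.pairExpect_mono (fun s a => (hmix s).1 a) fun s a b => ?_
    rw [show d s a b = -((r s a - r s b) - (P.rstar s a - P.rstar s b)) by rw [hd]; ring, neg_sq]
    exact sq_sub_div_le_one_sub_affinity (P.abs_sub_le_of_mem_rewardClass hr s a b)
      (P.abs_rstar_sub_le s a b)
  set X := P.pairExpect (mixture D) (fun s a b => d s a b ^ 2)
  set C := P.cov π (mixture D)
  have hC : 1 ≤ C := P.one_le_cov hπp hmix hmixpos
  have hdiff : (P.expect π P.rstar - P.expect P.πref P.rstar) - (P.expect π r - P.expect P.πref r)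
      = P.pairExpect π d := by
    rw [expect_sub_expect_πref P hπp, expect_sub_expect_πref P hπp, hd, ← pairExpect_sub]
  have hmax' := mul_le_mul_of_nonneg_left hmax (a := 1 / η) (by positivity)
  unfold rpoObj at hmax'
  have hcancel : ∀ z, 1 / η * (η * z) = z := fun z => by field_simp
  rw [mul_add, mul_add, hcancel, hcancel] at hmax'
  have hη1 : 1 / η * (nll D P.rstar - nll D r) ≤
      16 * Real.exp (2 * P.R) * √x / c - 1 / (8 * c * √x) * X := by
    calc _ ≤ 1 / η * (4 * x - 2 * (X / (16 * (1 + Real.exp P.R) ^ 2))) :=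
          mul_le_mul_of_nonneg_left (by linarith) (by positivity)
      _ = 4 * (1 + Real.exp P.R) ^ 2 * √x / c - 1 / (8 * c * √x) * X := by
        rw [hη]; nth_rewrite 2 [← hux]; field_simp; ring
      _ ≤ 4 * (4 * Real.exp (2 * P.R)) * √x / c - 1 / (8 * c * √x) * X := by
        gcongr; exact P.one_add_exp_sq_le
      _ = _ := by ring
  have hη2 : 1 / η * nll D rMLE ≤ 1 / η * nll D P.rstar :=
    mul_le_mul_of_nonneg_left hmle (by positivity)
  have hE : 1 ≤ Real.exp (2 * P.R) := Real.one_le_exp (by linarith [P.R_nonneg])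
  have hsmall : 16 * Real.exp (2 * P.R) * √x / c ≤ c * Real.exp (2 * P.R) * √x := by
    rw [div_le_iff₀ hc0]
    have : 0 < Real.exp (2 * P.R) * √x := by positivity
    nlinarith
  have hCk : C / (4 * (1 / (8 * c * √x))) = 2 * (c * √x) * C := by field_simp; ring
  rw [hCk] at hcov
  have ha : 2 * (c * √x) * C ≤ Real.exp (2 * P.R) * (2 * (c * √x) * C) :=
    le_mul_of_one_le_left (by positivity) hE
  -- The constant `5c` collects `2c` from Young, `2c` from the penalty in the estimate, and `c` from
  -- `hsmall`; the last two carry no coverage and are absorbed using `1 ≤ C`.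
  have hb : 3 * (c * Real.exp (2 * P.R) * √x) * 1 ≤ 3 * (c * Real.exp (2 * P.R) * √x) * C :=
    mul_le_mul_of_nonneg_left hC (by positivity)
  unfold vhatDstl
  rw [← hl', ← hx, ← hη', J_πref, J]
  linarith

end Estimate

end Problem

/-! ### The exponential supermartingale -/

section Supermartingale

variable {X Y Ω : Type*} [Fintype X] [MeasurableSpace X] [MeasurableSingletonClass X]

/-- Integrating out an observation with known conditional law. -/
lemma integral_mul_comp_eq_of_condExp {m mΩ : MeasurableSpace Ω} {μ : Measure Ω}
    [IsProbabilityMeasure μ] (hm : m ≤ mΩ) {obs : Ω → X}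
    (hobs : Measurable obs) {p : X → Ω → ℝ} (hlaw : ∀ x, μ⟦obs ⁻¹' {x} | m⟧ =ᵐ[μ] p x)
    {V : Ω → ℝ} (hV : StronglyMeasurable[m] V) {C : ℝ} (hC : ∀ᵐ ω ∂μ, |V ω| ≤ C) (h : X → ℝ) :
    Integrable (fun ω => V ω * ∑ x, p x ω * h x) μ ∧
      ∫ ω, V ω * h (obs ω) ∂μ = ∫ ω, V ω * ∑ x, p x ω * h x ∂μ := by
  have hset : ∀ x, MeasurableSet (obs ⁻¹' {x}) := fun x => hobs (measurableSet_singleton x)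
  have hind : ∀ x, Integrable ((obs ⁻¹' {x}).indicator fun _ => (1 : ℝ)) μ := fun x =>
    (integrable_const _).indicator (hset x)
  have hVi : ∀ x, Integrable (V * (obs ⁻¹' {x}).indicator fun _ => (1 : ℝ)) μ := fun x =>
    (hind x).bdd_mul (hV.mono hm).aestronglyMeasurable (by simpa using hC)
  have hce : ∀ x, μ[V * (obs ⁻¹' {x}).indicator fun _ => (1 : ℝ) | m] =ᵐ[μ]
      fun ω => V ω * p x ω := fun x => by
    filter_upwards [condExp_mul_of_stronglyMeasurable_left hV (hVi x) (hind x), hlaw x]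
      with ω h1 h2
    rw [h1, Pi.mul_apply, h2]
  have hVp : ∀ x, Integrable (fun ω => V ω * p x ω) μ := fun x =>
    integrable_condExp.congr (hce x)
  have hint : ∀ x, ∫ ω, (V * (obs ⁻¹' {x}).indicator fun _ => (1 : ℝ)) ω ∂μ
      = ∫ ω, V ω * p x ω ∂μ := fun x => by
    rw [← integral_condExp hm, integral_congr_ae (hce x)]
  have e1 : (fun ω => V ω * ∑ x, p x ω * h x) = fun ω => ∑ x, V ω * p x ω * h x := by
    funext ω; rw [Finset.mul_sum]; exact Finset.sum_congr rfl fun x _ => by ring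
  have e2 : (fun ω => V ω * h (obs ω)) = fun ω =>
      ∑ x, (V * (obs ⁻¹' {x}).indicator fun _ => (1 : ℝ)) ω * h x := by
    classical
    funext ω
    rw [Finset.sum_eq_single (obs ω)]
    · simp
    · intro x _ hx
      have : ω ∉ obs ⁻¹' {x} := fun h' => hx h'.symm
      simp [Set.indicator_of_notMem this]
    · simp
  rw [e1, e2]
  refine ⟨integrable_finsetSum _ fun x _ => (hVp x).mul_const _, ?_⟩
  rw [integral_finsetSum _ fun x _ => (hVi x).mul_const _,
    integral_finsetSum _ fun x _ => (hVp x).mul_const _]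
  refine Finset.sum_congr rfl fun x _ => ?_
  rw [integral_mul_const, integral_mul_const, hint]

variable [MeasurableSpace Y] [mΩ : MeasurableSpace Ω] {μ : Measure Ω} [IsProbabilityMeasure μ]
  {𝓕 : Filtration ℕ mΩ} {pol : ℕ → Ω → Y} {obs : ℕ → Ω → X} {T : ℕ}
  {p : Y → X → ℝ} {f : X → ℝ} {g : Y → ℝ} {G : Set Y} {C : ℝ}

/-- Integrating out the last observation costs at most `exp (-g)`, which cancels the compensator
`exp g`. Membership in `G` holds only almost surely, hence the almost-sure bounds. -/
lemma integral_exp_sum_le_one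
    (hpol : ∀ t < T, Measurable[𝓕 (t + 1)] (pol t))
    (hobs : ∀ t < T, Measurable[𝓕 (t + 1)] (obs t))
    (hlaw : ∀ t < T, ∀ x, μ⟦obs t ⁻¹' {x} | 𝓕 t ⊔ MeasurableSpace.comap (pol t) inferInstance⟧
      =ᵐ[μ] fun ω => p (pol t ω) x)
    (hg : Measurable g) (hG : ∀ t < T, ∀ᵐ ω ∂μ, pol t ω ∈ G) (hgC : ∀ y ∈ G, |g y| ≤ C)
    (hle : ∀ y ∈ G, ∑ x, p y x * Real.exp (f x) ≤ Real.exp (-g y)) :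
    ∀ t ≤ T, Integrable (fun ω => Real.exp (∑ i ∈ Finset.range t, (f (obs i ω) + g (pol i ω)))) μ ∧
      ∫ ω, Real.exp (∑ i ∈ Finset.range t, (f (obs i ω) + g (pol i ω))) ∂μ ≤ 1 := by
  have hf : Measurable f := measurable_of_finite f
  have hmeas : ∀ t ≤ T, Measurable[𝓕 t] fun ω =>
      Real.exp (∑ i ∈ Finset.range t, (f (obs i ω) + g (pol i ω))) := by
    intro t ht
    refine Real.measurable_exp.comp (Finset.measurable_fun_sum _ fun i hi => ?_)
    rw [Finset.mem_range] at hi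
    exact (hf.comp ((hobs i (by omega)).mono (𝓕.mono (by omega)) le_rfl)).add
      (hg.comp ((hpol i (by omega)).mono (𝓕.mono (by omega)) le_rfl))
  obtain ⟨F, hF⟩ : ∃ F, ∀ x, |f x| ≤ F := by
    refine ⟨∑ x, |f x|, fun x => Finset.single_le_sum (f := fun x => |f x|)
      (fun _ _ => abs_nonneg _) (Finset.mem_univ x)⟩
  have hbound : ∀ t ≤ T, ∀ᵐ ω ∂μ,
      |Real.exp (∑ i ∈ Finset.range t, (f (obs i ω) + g (pol i ω)))| ≤ Real.exp (t * (F + C)) := by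
    intro t ht
    have : ∀ᵐ ω ∂μ, ∀ i < T, pol i ω ∈ G := by
      rw [ae_all_iff]; intro i
      by_cases hi : i < T
      · filter_upwards [hG i hi] with ω h _ using h
      · exact Filter.Eventually.of_forall fun ω h => absurd h hi
    filter_upwards [this] with ω hω
    rw [abs_of_pos (Real.exp_pos _), Real.exp_le_exp]
    calc _ ≤ ∑ i ∈ Finset.range t, (F + C) := by
          refine Finset.sum_le_sum fun i hi => ?_
          rw [Finset.mem_range] at hi
          exact add_le_add ((le_abs_self _).trans (hF _))
            ((le_abs_self _).trans (hgC _ (hω i (by omega))))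
      _ = _ := by rw [Finset.sum_const, Finset.card_range, nsmul_eq_mul]
  have hint : ∀ t ≤ T, Integrable (fun ω =>
      Real.exp (∑ i ∈ Finset.range t, (f (obs i ω) + g (pol i ω)))) μ := fun t ht =>
    Integrable.of_bound ((hmeas t ht).mono (𝓕.le t) le_rfl).aestronglyMeasurable _ (hbound t ht)
  intro t ht
  refine ⟨hint t ht, ?_⟩
  induction t with
  | zero => simp
  | succ t ih =>
    have ht' : t < T := ht
    refine le_trans ?_ (ih ht'.le)
    set M := fun ω => Real.exp (∑ i ∈ Finset.range t, (f (obs i ω) + g (pol i ω))) with hM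
    -- Conditioning must include the policy of round `t`, which may be random given `𝓕 t`; then
    -- everything but the observation is known.
    have hmle : 𝓕 t ⊔ MeasurableSpace.comap (pol t) inferInstance ≤ mΩ := sup_le (𝓕.le t)
      ((hpol t ht').mono (𝓕.le _) le_rfl).comap_le
    have hV : StronglyMeasurable[𝓕 t ⊔ MeasurableSpace.comap (pol t) inferInstance] fun ω => M ω * Real.exp (g (pol t ω)) := by
      refine Measurable.stronglyMeasurable ?_
      refine ((hmeas t ht'.le).mono le_sup_left le_rfl).mul ?_
      refine Real.measurable_exp.comp (hg.comp ?_)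
      exact (comap_measurable (pol t)).mono le_sup_right le_rfl
    have hVC : ∀ᵐ ω ∂μ, |M ω * Real.exp (g (pol t ω))| ≤ Real.exp (t * (F + C)) * Real.exp C := by
      filter_upwards [hbound t ht'.le, hG t ht'] with ω h1 h2
      rw [abs_mul]
      refine mul_le_mul h1 ?_ (abs_nonneg _) (Real.exp_pos _).le
      rw [abs_of_pos (Real.exp_pos _), Real.exp_le_exp]
      exact (le_abs_self _).trans (hgC _ h2)
    obtain ⟨hi, he⟩ := integral_mul_comp_eq_of_condExp hmle ((hobs t ht').mono (𝓕.le _) le_rfl)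
      (hlaw t ht') hV hVC fun x => Real.exp (f x)
    have e : ∀ ω, Real.exp (∑ i ∈ Finset.range (t + 1), (f (obs i ω) + g (pol i ω)))
        = M ω * Real.exp (g (pol t ω)) * Real.exp (f (obs t ω)) := by
      intro ω
      rw [Finset.sum_range_succ, Real.exp_add, Real.exp_add]; ring
    simp only [e]
    rw [he]
    refine integral_mono_ae hi (hint t ht'.le) ?_
    filter_upwards [hG t ht'] with ω hω
    calc M ω * Real.exp (g (pol t ω)) * ∑ x, p (pol t ω) x * Real.exp (f x)
        ≤ M ω * Real.exp (g (pol t ω)) * Real.exp (-g (pol t ω)) :=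
          mul_le_mul_of_nonneg_left (hle _ hω) (by positivity)
      _ = M ω := by rw [mul_assoc, ← Real.exp_add]; simp

omit [IsProbabilityMeasure μ] in
lemma measure_lt_le_of_integral_exp_le_one [IsFiniteMeasure μ] {Z : Ω → ℝ}
    (hi : Integrable (fun ω => Real.exp (Z ω)) μ) (h1 : ∫ ω, Real.exp (Z ω) ∂μ ≤ 1) {ε : ℝ}
    (hε : 0 < ε) : μ {ω | Real.log (1 / ε) < Z ω} ≤ ENNReal.ofReal ε := by
  have h := mul_meas_ge_le_integral_of_nonneg (μ := μ)
    (Filter.Eventually.of_forall fun ω => (Real.exp_pos (Z ω)).le) hi (1 / ε)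
  have hsub : {ω | Real.log (1 / ε) < Z ω} ⊆ {ω | 1 / ε ≤ Real.exp (Z ω)} := by
    intro ω hω
    exact ((Real.log_lt_iff_lt_exp (by positivity)).mp hω).le
  refine (measure_mono hsub).trans ?_
  rw [← ofReal_measureReal]
  apply ENNReal.ofReal_le_ofReal
  have h2 := h.trans h1
  rwa [div_mul_eq_mul_div, one_mul, div_le_one hε] at h2

end Supermartingale

/-! ### Uniform concentration over rewards and prefixes -/

section Concentration

variable {S A : Type*} [Fintype S] [Fintype A] {P : Problem S A} {Pi : Finset (Policy S A)}
  {Ω : Type*} [mΩ : MeasurableSpace Ω] {μ : Measure Ω} [IsProbabilityMeasure μ]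
  {𝓕 : Filtration ℕ mΩ} {pol : ℕ → Ω → Policy S A} {obs : ℕ → Ω → Obs S A} {T : ℕ}

lemma Problem.measurable_hell (P : Problem S A) (r : Reward S A) : Measurable (P.hell r) := by
  unfold Problem.hell Problem.pairExpect
  fun_prop

/-- With high probability the likelihood ratios of all rewards of the class concentrate on all
prefixes of the data. -/
lemma measure_not_concentrates_le
    (hpol : ∀ t < T, Measurable[𝓕 (t + 1)] (pol t))
    (hobs : ∀ t < T, Measurable[𝓕 (t + 1)] (obs t))
    (hlaw : ∀ t < T, SamplesObs P μ (𝓕 t) (pol t) (obs t))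
    (hG : ∀ t < T, ∀ᵐ ω ∂μ, IsPolicy (pol t ω)) {δ : ℝ} (hδ : 0 < δ) (hδ1 : δ < 1) (hT : 2 ≤ T)
    (hPi : Pi.Nonempty) :
    μ {ω | ¬ ∀ t < T, P.Concentrates Pi (dataBefore pol obs t ω) (Real.log (Pi.card * T / δ))}
      ≤ ENNReal.ofReal (δ / 2) := by
  have hcard : (1 : ℝ) ≤ Pi.card := by exact_mod_cast hPi.card_pos
  have hT2 : (2 : ℝ) ≤ T := by exact_mod_cast hT
  -- The budget `δ / 2` is split evenly over `T` prefixes and `|Pi|` rewards.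
  set ε : ℝ := δ / 2 / (T * Pi.card) with hε
  have hεpos : 0 < ε := by positivity
  -- Here `1 / ε = 2 |Pi| T / δ`, and the extra `log 2` is absorbed because `|Pi| T / δ ≥ 2`, thanks
  -- to `T ≥ 2`.
  have hlog : Real.log (1 / ε) ≤ 2 * Real.log (Pi.card * T / δ) := by
    have h2 : 2 ≤ Pi.card * T / δ := by
      rw [le_div_iff₀ hδ]; nlinarith
    have e : 1 / ε = 2 * (Pi.card * T / δ) := by rw [hε]; field_simp
    rw [e, Real.log_mul (by norm_num) (by positivity), two_mul]
    gcongr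
  have hMeas : MeasurableSingletonClass (Obs S A) := ⟨fun _ => trivial⟩
  have hsingle : ∀ t < T, ∀ r : Reward S A,
      μ {ω | Real.log (1 / ε) < ∑ i ∈ Finset.range t,
        (halfLogRatio r P.rstar (obs i ω) + P.hell r (pol i ω))} ≤ ENNReal.ofReal ε := by
    intro t ht r
    obtain ⟨h1, h2⟩ := integral_exp_sum_le_one (p := P.obsProb) (f := halfLogRatio r P.rstar)
      (g := P.hell r) (G := {π | IsPolicy π}) (C := 1) hpol hobs hlaw (P.measurable_hell r) hG
      (fun π hπ => by
        rw [abs_of_nonneg (P.hell_nonneg r hπ)]; exact P.hell_le_one r hπ)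
      (fun π hπ => P.sum_obsProb_mul_exp_le r hπ) t ht.le
    exact measure_lt_le_of_integral_exp_le_one h1 h2 hεpos
  have hsub : {ω | ¬ ∀ t < T, P.Concentrates Pi (dataBefore pol obs t ω)
      (Real.log (Pi.card * T / δ))} ⊆ ⋃ t ∈ Finset.range T, ⋃ π ∈ Pi,
        {ω | Real.log (1 / ε) < ∑ i ∈ Finset.range t,
        (halfLogRatio (P.rewardOf π) P.rstar (obs i ω) + P.hell (P.rewardOf π) (pol i ω))} := by
    intro ω hω
    simp only [Set.mem_ofPred_eq, Problem.Concentrates, not_forall, not_le] at hω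
    obtain ⟨t, ht, r, ⟨π, hπ, rfl⟩, h⟩ := hω
    simp only [Set.mem_iUnion, Finset.mem_range]
    refine ⟨t, ht, π, hπ, lt_of_le_of_lt hlog ?_⟩
    rw [← Fin.sum_univ_eq_sum_range fun i =>
      halfLogRatio (P.rewardOf π) P.rstar (obs i ω) + P.hell (P.rewardOf π) (pol i ω)]
    exact h
  calc _ ≤ _ := measure_mono hsub
    _ ≤ ∑ t ∈ Finset.range T, ∑ π ∈ Pi, ENNReal.ofReal ε := by
        refine (measure_biUnion_finset_le _ _).trans (Finset.sum_le_sum fun t ht => ?_)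
        exact (measure_biUnion_finset_le _ _).trans
          (Finset.sum_le_sum fun π _ => hsingle t (Finset.mem_range.mp ht) _)
    _ = ENNReal.ofReal (δ / 2) := by
        simp only [Finset.sum_const, Finset.card_range, nsmul_eq_mul]
        rw [← ENNReal.ofReal_natCast, ← ENNReal.ofReal_natCast, ← ENNReal.ofReal_mul (by positivity),
          ← ENNReal.ofReal_mul (by positivity), hε]
        congr 1
        field_simp

end Concentration

/-! ### Timing of the online rounds -/

section OnlineTime

variable {N q : ℕ}

lemma olTime_mul_add {a b : ℕ} (hb : b < q) : olTime N q (a * q + b) = a * N + b := by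
  unfold olTime
  rw [mul_comm a q, Nat.mul_add_mod, Nat.mul_add_div (by omega), Nat.div_eq_of_lt hb,
    Nat.mod_eq_of_lt hb, add_zero]

/-- Consecutive online rounds are adjacent inside a block; at the end of a block the transfer rounds
are skipped. -/
lemma olTime_strictMono (hq : 0 < q) (hqN : q < N) : StrictMono (olTime N q) := by
  refine strictMono_nat_of_lt_succ fun j => ?_
  have hj := Nat.div_add_mod' j q
  have hb := Nat.mod_lt j hq
  generalize j / q = a at *
  generalize j % q = b at *
  subst hj
  rw [olTime_mul_add hb]
  rcases Nat.lt_or_ge (b + 1) q with h | h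
  · rw [add_assoc, olTime_mul_add h]; omega
  · have : a * q + b + 1 = (a + 1) * q + 0 := by rw [add_mul]; omega
    rw [this, olTime_mul_add hq, add_mul]; omega

lemma olTime_lt (hq : 0 < q) (hqN : q < N) {j k : ℕ} (hj : j < k * q) : olTime N q j < k * N := by
  have := olTime_strictMono hq hqN hj
  have h := olTime_mul_add (N := N) (q := q) (a := k) hq
  simp only [add_zero] at h
  omega

/-- At a transfer round the online phase of the current block is complete, so `t / N + 1` full
online phases lie in the past. -/
lemma olTime_lt_of_le_mod (hq : 0 < q) (hqN : q < N) {j t : ℕ} (ht : q ≤ t % N)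
    (hj : j < (t / N + 1) * q) : olTime N q j < t := by
  have h1 : j ≤ t / N * q + (q - 1) := by rw [add_mul] at hj; omega
  have h2 := (olTime_strictMono hq hqN).monotone h1
  rw [olTime_mul_add (by omega)] at h2
  have h3 := Nat.div_add_mod' t N
  omega

end OnlineTime

/-! ### Almost-sure properties of a run and its online subprocess -/

section Run

variable {S : Type u} {A : Type v} [Fintype S] [Fintype A] {P : Problem S A}
  {Pi : Finset (Policy S A)}
  {Ω : Type w} [mΩ : MeasurableSpace Ω] {μ : Measure Ω} [IsProbabilityMeasure μ]

-- The conditional probability of `B` is constantly `1`; integrating it gives total probability `1`.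
omit [Fintype S] [Fintype A] mΩ in
lemma ae_mem_of_samplesPolicy {m mΩ : MeasurableSpace Ω} {μ : Measure Ω} [IsProbabilityMeasure μ]
    (hm : m ≤ mΩ) {j : ℕ}
    {κ : Kernel (Dataset S A j) (Policy S A)} [IsMarkovKernel κ] {D : Ω → Dataset S A j}
    {pol : Ω → Policy S A} (hpol : Measurable pol) (h : SamplesPolicy μ m κ D pol)
    {B : Set (Policy S A)} (hB : MeasurableSet B) (hκ : ∀ D, ∀ᵐ π ∂(κ D), π ∈ B) :
    ∀ᵐ ω ∂μ, pol ω ∈ B := by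
  have h1 : ∀ D, (κ D).real B = 1 := fun D => by
    have := mem_ae_iff_prob_eq_one hB |>.mp (hκ D)
    simp [measureReal_def, this]
  have h2 := h B hB
  simp only [h1] at h2
  have h3 : μ.real (pol ⁻¹' B) = 1 := by
    have e := integral_condExp (μ := μ) hm (f := (pol ⁻¹' B).indicator fun _ => (1 : ℝ))
    rw [integral_congr_ae h2, integral_indicator_const _ (hpol hB)] at e
    simpa using e.symm
  have h4 : μ (pol ⁻¹' B) = 1 := by
    rw [← ofReal_measureReal, h3, ENNReal.ofReal_one]
  exact (mem_ae_iff_prob_eq_one (hpol hB)).mpr h4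

variable {W : ℕ} {src : Fin W → Reward S A} {alg : ℕ → ℝ → OnlineRule S A} {COL c₀ CPi c δ δ₀ α : ℝ}
  {K N : ℕ} {𝓕 : Filtration ℕ mΩ} {pol : ℕ → Ω → Policy S A} {obs : ℕ → Ω → Obs S A}

lemma IsTPORun.ae_online_mem (hrun : IsTPORun P Pi src alg K N α c δ δ₀ μ 𝓕 pol obs)
    (halg : IsNoRegret.{u, v, w} P Pi COL c₀ CPi alg) (hq : 0 < ⌊α * N⌋₊) (hqN : ⌊α * N⌋₊ < N)
    {j : ℕ} (hj : j < K * ⌊α * N⌋₊) :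
    ∀ᵐ ω ∂μ, pol (olTime N ⌊α * N⌋₊ j) ω ∈ convexHull ℝ (Pi : Set (Policy S A)) := by
  have := halg.markov (K * ⌊α * N⌋₊) δ₀ j
  exact ae_mem_of_samplesPolicy (𝓕.le _)
    ((hrun.pol_meas _ (olTime_lt hq hqN hj)).mono (𝓕.le _) le_rfl) (hrun.online j hj)
    (Set.Finite.isCompact_convexHull ℝ Pi.finite_toSet).isClosed.measurableSet
    (halg.mem (K * ⌊α * N⌋₊) δ₀ j)

/-- Source policies need not lie in the hull, so only positivity is claimed for all rounds: they
have it by their exponential form, the others by lying in the hull. -/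
lemma IsTPORun.ae_policy_pos (hrun : IsTPORun P Pi src alg K N α c δ δ₀ μ 𝓕 pol obs)
    (hG : P.GoodClass Pi)
    (halg : IsNoRegret.{u, v, w} P Pi COL c₀ CPi alg) (hq : 0 < ⌊α * N⌋₊) (hqN : ⌊α * N⌋₊ < N)
    {t : ℕ} (ht : t < K * N) :
    ∀ᵐ ω ∂μ, IsPolicy (pol t ω) ∧ ∀ s a, 0 < pol t ω s a := by
  rcases Nat.lt_or_ge (t % N) ⌊α * N⌋₊ with h | h
  · have hk : t / N < K := Nat.div_lt_of_lt_mul (by rwa [mul_comm])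
    have hj : t / N * ⌊α * N⌋₊ + t % N < K * ⌊α * N⌋₊ := by
      calc _ < (t / N + 1) * ⌊α * N⌋₊ := by rw [add_mul]; omega
        _ ≤ _ := Nat.mul_le_mul_right _ hk
    have := hrun.ae_online_mem halg hq hqN hj
    rw [olTime_mul_add h, Nat.div_add_mod'] at this
    filter_upwards [this] with ω hω using hG.policy_pos_of_mem_convexHull hω
  · filter_upwards [hrun.transfer t ht h] with ω hω
    obtain ⟨rM, πD, rD, hcall, ⟨rfl, -⟩ | ⟨w, hw, -⟩⟩ := hω
    · exact hG.policy_pos_of_mem_convexHull hcall.rpo.mem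
    · rw [hw]; exact ⟨P.opt_policy _, P.opt_pos _⟩

-- The filtration is sampled at the online times, so it also records the intervening transfer data.
-- The regret guarantee allows any filtration given which the rule's conditional law uses only the
-- online data.
omit [IsProbabilityMeasure μ] in
lemma IsTPORun.isOnlineRun (hrun : IsTPORun P Pi src alg K N α c δ δ₀ μ 𝓕 pol obs)
    (hq : 0 < ⌊α * N⌋₊) (hqN : ⌊α * N⌋₊ < N) :
    IsOnlineRun P (alg (K * ⌊α * N⌋₊) δ₀) (K * ⌊α * N⌋₊) μ
      ⟨fun j => 𝓕 (olTime N ⌊α * N⌋₊ j),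
        fun _ _ h => 𝓕.mono ((olTime_strictMono hq hqN).monotone h), fun _ => 𝓕.le _⟩
      (fun j => pol (olTime N ⌊α * N⌋₊ j)) (fun j => obs (olTime N ⌊α * N⌋₊ j)) where
  pol_meas j hj := (hrun.pol_meas _ (olTime_lt hq hqN hj)).mono
    (𝓕.mono (olTime_strictMono hq hqN (Nat.lt_succ_self j))) le_rfl
  obs_meas j hj := (hrun.obs_meas _ (olTime_lt hq hqN hj)).mono
    (𝓕.mono (olTime_strictMono hq hqN (Nat.lt_succ_self j))) le_rfl
  pol_law j hj := hrun.online j hj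
  obs_law _ hj := hrun.obs_law _ (olTime_lt hq hqN hj)

end Run

/-! ### The average online policy as comparator -/

section Comparator

variable {S A : Type*} [Fintype S] [Fintype A] {P : Problem S A} {Pi : Finset (Policy S A)}

/-- The uniform average of the first `j` policies of a sequence. -/
def averagePolicy (p : ℕ → Policy S A) (j : ℕ) : Policy S A :=
  ∑ i ∈ Finset.range j, (1 / (j : ℝ)) • p i

lemma sum_range_one_div {j : ℕ} (hj : 0 < j) : ∑ _i ∈ Finset.range j, 1 / (j : ℝ) = 1 := by
  have : (j : ℝ) ≠ 0 := by positivity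
  rw [Finset.sum_const, Finset.card_range, nsmul_eq_mul]
  field_simp

/-- Jensen's inequality for the concave `J`: online-to-batch conversion of regret. -/
lemma Problem.sub_div_le_J_averagePolicy {p : ℕ → Policy S A} {j : ℕ} (hj : 0 < j)
    (hp : ∀ i < j, ∀ s a, 0 ≤ p i s a) {v B : ℝ}
    (h : ∑ i ∈ Finset.range j, (v - P.J (p i)) ≤ B) :
    v - B / j ≤ P.J (averagePolicy p j) := by
  have hj' : (0 : ℝ) < j := by positivity
  have h1 := P.concaveOn_J.le_map_sum (t := Finset.range j) (w := fun _ => 1 / (j : ℝ)) (p := p)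
    (fun _ _ => by positivity) (sum_range_one_div hj)
    fun i hi => hp i (Finset.mem_range.mp hi)
  refine le_trans ?_ h1
  simp only [smul_eq_mul]
  rw [← Finset.mul_sum]
  rw [Finset.sum_sub_distrib, Finset.sum_const, Finset.card_range, nsmul_eq_mul] at h
  rw [sub_le_iff_le_add, ← sub_le_iff_le_add', le_div_iff₀ hj']
  have : (v - 1 / (j : ℝ) * ∑ i ∈ Finset.range j, P.J (p i)) * j
      = j * v - ∑ i ∈ Finset.range j, P.J (p i) := by
    field_simp
  linarith

omit [Fintype S] [Fintype A] in
lemma averagePolicy_mem {p : ℕ → Policy S A} {j : ℕ} (hj : 0 < j)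
    (hp : ∀ i < j, p i ∈ convexHull ℝ (Pi : Set (Policy S A))) :
    averagePolicy p j ∈ convexHull ℝ (Pi : Set (Policy S A)) :=
  (convex_convexHull ℝ _).sum_mem (fun _ _ => by positivity) (sum_range_one_div hj)
    fun i hi => hp i (Finset.mem_range.mp hi)

omit [Fintype S] [Fintype A] in
/-- A subsequence average is dominated by the average of the whole sequence. -/
lemma averagePolicy_comp_le {t j : ℕ} (hj : 0 < j) {D : Dataset S A t} {p : ℕ → Policy S A}
    (hD : ∀ i, (D i).2 = p i) (hp : ∀ i < t, ∀ s a, 0 ≤ p i s a) {τ : ℕ → ℕ}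
    (hτ : StrictMono τ) (hτt : ∀ i < j, τ i < t) {k : ℝ} (hk : t ≤ k * j) (s : S) (a : A) :
    averagePolicy (fun i => p (τ i)) j s a ≤ k * mixture D s a := by
  have hj' : (0 : ℝ) < j := by positivity
  have ht : 0 < t := (Nat.zero_le _).trans_lt (hτt 0 hj)
  have ht' : (0 : ℝ) < t := by positivity
  have h1 : ∑ i ∈ Finset.range j, p (τ i) s a ≤ ∑ i ∈ Finset.range t, p i s a := by
    rw [← Finset.sum_image (f := fun i => p i s a) (g := τ) hτ.injective.injOn]
    refine Finset.sum_le_sum_of_subset_of_nonneg ?_ fun i hi _ =>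
      hp i (Finset.mem_range.mp hi) s a
    intro i hi
    obtain ⟨i', hi', rfl⟩ := Finset.mem_image.mp hi
    exact Finset.mem_range.mpr (hτt i' (Finset.mem_range.mp hi'))
  have h0 : 0 ≤ ∑ i ∈ Finset.range t, p i s a :=
    Finset.sum_nonneg fun i hi => hp i (Finset.mem_range.mp hi) s a
  have e1 : averagePolicy (fun i => p (τ i)) j s a
      = (∑ i ∈ Finset.range j, p (τ i) s a) / j := by
    simp [averagePolicy, Finset.sum_apply, ← Finset.mul_sum, div_eq_inv_mul]
  have e2 : mixture D s a = (∑ i ∈ Finset.range t, p i s a) / t := by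
    rw [mixture, ← Fin.sum_univ_eq_sum_range fun i => p i s a]
    simp only [hD]
    ring
  rw [e1, e2, div_le_iff₀ hj']
  calc _ ≤ ∑ i ∈ Finset.range t, p i s a := h1
    _ = (∑ i ∈ Finset.range t, p i s a) / t * t := by field_simp
    _ ≤ (∑ i ∈ Finset.range t, p i s a) / t * (k * j) := by gcongr
    _ = _ := by ring

end Comparator

/-! ### Numerical inequalities -/

section Constants

/-- The TPS terms carry a first power of the logarithm and the target the power `c₀`; as `1 - c₀ ≤
0`, `L ^ (1 - c₀)` is largest at `log 2`. -/
lemma le_mul_rpow_of_log_two_le {L c₀ : ℝ} (hL : Real.log 2 ≤ L) (hc₀ : 1 ≤ c₀) :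
    L ≤ Real.log 2 ^ (1 - c₀) * L ^ c₀ := by
  have h2 : 0 < Real.log 2 := Real.log_pos (by norm_num)
  have hL0 : 0 < L := h2.trans_le hL
  calc L = L ^ (1 - c₀) * L ^ c₀ := by rw [← Real.rpow_add hL0]; simp
    _ ≤ _ := by
      gcongr ?_ * _
      exact Real.rpow_le_rpow_of_nonpos h2 hL (by linarith)

/-- Converts regret averaged over `j` online rounds into a rate in the total number `t` of rounds.
The bound by `max 1 C` also covers a negative complexity. -/
lemma sqrt_mul_le_of_le {C j k t l L : ℝ} (hj : 0 < j) (ht : 0 < t) (hk : 1 ≤ k) (htj : t ≤ k * j)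
    (hl : 0 ≤ l) (hlL : l ≤ L) : √(C * j * l) / j ≤ k * √(max 1 C) * √(1 / t * L) := by
  have hC : 0 ≤ max 1 C := by positivity
  have hL : 0 ≤ L := hl.trans hlL
  rw [div_le_iff₀ hj]
  refine Real.sqrt_le_iff.mpr ⟨by positivity, ?_⟩
  have e : (k * √(max 1 C) * √(1 / t * L) * j) ^ 2 = max 1 C * (k * j * (k * j / t)) * L := by
    rw [mul_pow, mul_pow, mul_pow, Real.sq_sqrt hC, Real.sq_sqrt (by positivity)]; ring
  rw [e]
  have h1 : j ≤ k * j * (k * j / t) := by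
    have : 1 ≤ k * j / t := by rwa [le_div_iff₀ ht, one_mul]
    nlinarith
  calc C * j * l ≤ max 1 C * j * l := by gcongr; exact le_max_right _ _
    _ ≤ _ := by gcongr

lemma le_two_mul_floor {x : ℝ} (hx : 1 ≤ x) : x ≤ 2 * (⌊x⌋₊ : ℝ) := by
  have h1 : (1 : ℝ) ≤ ⌊x⌋₊ := by exact_mod_cast Nat.le_floor (by simpa using hx)
  linarith [Nat.lt_floor_add_one x]

end Constants

/-! ### Both bounds for a single TPS call -/

section Call

variable {S A : Type*} [Fintype S] [Fintype A] {P : Problem S A} {Pi : Finset (Policy S A)}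
  {Ω : Type*} {pol : ℕ → Ω → Policy S A} {obs : ℕ → Ω → Obs S A} {COL c₀ CPi c δ δ₀ α : ℝ}
  {K N t : ℕ}

/-- The bounds on the self-transfer estimate of one call, on the event where the likelihood ratios
concentrate and the online rule has low regret. -/
lemma estimate_bounds (hc : √24 ≤ c) (hCOL : 0 < COL) (hc₀ : 1 ≤ c₀) (hG : P.GoodClass Pi)
    (hα : 0 < α) (hα1 : α < 1) (hαN : 1 ≤ α * N) (hδ1 : δ < 1) (hδ₀ : 0 < δ₀) (hδ₀δ : δ₀ ≤ δ)
    {ω : Ω} (hpol : ∀ i < K * N, IsPolicy (pol i ω) ∧ ∀ s a, 0 < pol i ω s a)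
    (hmem : ∀ j < K * ⌊α * N⌋₊,
      pol (olTime N ⌊α * N⌋₊ j) ω ∈ convexHull ℝ (Pi : Set (Policy S A)))
    (hregret : ∀ j ≤ K * ⌊α * N⌋₊,
      ∑ i ∈ Finset.range j, (P.J (P.opt P.rstar) - P.J (pol (olTime N ⌊α * N⌋₊ i) ω)) ≤
        COL * P.R * Real.exp (2 * P.R) *
          √(CPi * j * Real.log (Pi.card * (K * ⌊α * N⌋₊ : ℕ) / δ₀) ^ c₀))
    (ht : t < K * N) (htN : ⌊α * N⌋₊ ≤ t % N)
    (hconc : P.Concentrates Pi (dataBefore pol obs t ω)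
      (Real.log (Pi.card * (K * N : ℕ) / δ)))
    {rMLE rD : Reward S A} {πD : Policy S A}
    (hcall : P.IsTPSCall Pi c δ (K * N) (dataBefore pol obs t ω) rMLE πD rD) :
    P.J (P.opt P.rstar) - P.J P.πref
        - (2 * COL + 10 * c * √(Real.log 2 ^ (1 - c₀))) * (max 1 P.R * Real.exp (2 * P.R)) *
          min (P.cov (P.opt P.rstar) (mixture (dataBefore pol obs t ω))) (√(max 1 CPi) / α) *
          √(1 / (t : ℝ) * Real.log (Pi.card * (K * N : ℕ) / δ₀) ^ c₀)
      ≤ P.vhatDstl Pi c δ (K * N) (dataBefore pol obs t ω) rMLE πD rD ∧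
    P.vhatDstl Pi c δ (K * N) (dataBefore pol obs t ω) rMLE πD rD ≤ P.J πD - P.J P.πref := by
  have hδ : 0 < δ := hδ₀.trans_le hδ₀δ
  have hN0 : (0 : ℝ) < N := by
    by_contra h
    have : α * N ≤ 0 := mul_nonpos_of_nonneg_of_nonpos hα.le (not_lt.mp h)
    linarith
  have hq2 := le_two_mul_floor hαN
  have hq : 0 < ⌊α * N⌋₊ := Nat.floor_pos.mpr hαN
  have hqN : ⌊α * N⌋₊ < N := by
    rw [Nat.floor_lt (by positivity)]; nlinarith
  generalize ⌊α * (N : ℝ)⌋₊ = q at *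
  -- A transfer round has `t % N ≥ q ≥ 1`, so the dataset is never empty.
  have ht0 : 0 < t := by
    have := Nat.mod_le t N
    omega
  have ht0' : (0 : ℝ) < t := by positivity
  have hK : 0 < K := Nat.pos_of_mul_pos_right (Nat.zero_lt_of_lt ht)
  have hcard : (1 : ℝ) ≤ Pi.card := by exact_mod_cast Finset.card_pos.mpr ⟨_, hG.realizable⟩
  -- From `1 ≤ q < N`.
  have hKN : (2 : ℝ) ≤ (K * N : ℕ) := by
    have : 2 ≤ K * N := by nlinarith
    exact_mod_cast this
  have hKq : (1 : ℝ) ≤ (K * q : ℕ) := by exact_mod_cast Nat.mul_pos hK hq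
  have hKqN : ((K * q : ℕ) : ℝ) ≤ (K * N : ℕ) := by
    exact_mod_cast Nat.mul_le_mul_left K hqN.le
  set l := Real.log (Pi.card * (K * N : ℕ) / δ) with hl
  set L := Real.log (Pi.card * (K * N : ℕ) / δ₀) with hL
  have hl2 : Real.log 2 ≤ l := by
    apply Real.log_le_log (by norm_num)
    rw [le_div_iff₀ hδ]; nlinarith
  have hlL : l ≤ L := by
    apply Real.log_le_log (by positivity)
    gcongr
  have hlog2 : 0 < Real.log 2 := Real.log_pos (by norm_num)
  have hl0 : 0 < l := hlog2.trans_le hl2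
  have hL0 : 0 < L := hl0.trans_le hlL
  have hc0 : 0 < c := lt_of_lt_of_le (by positivity) hc
  have hDpol : ∀ i, IsPolicy (dataBefore pol obs t ω i).2 := fun i =>
    (hpol i (i.2.trans ht)).1
  have hDpos : ∀ i s a, 0 < (dataBefore pol obs t ω i).2 s a := fun i =>
    (hpol i (i.2.trans ht)).2
  refine ⟨?_, Problem.vhatDstl_le hc hG ht0 hl0 hconc hDpol hcall⟩
  have hlow := fun π hπ => Problem.le_vhatDstl (π := π) hc hG ht0 hl0 hconc hDpol hDpos hcall hπ
  rw [← hl] at hlow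
  set κ := Real.log 2 ^ (1 - c₀)
  have hκ : 0 < κ := Real.rpow_pos_of_pos hlog2 _
  set v := √(1 / (t : ℝ) * L ^ c₀) with hv
  have huv : √(1 / (t : ℝ) * l) ≤ √κ * v := by
    rw [hv, ← Real.sqrt_mul hκ.le]
    apply Real.sqrt_le_sqrt
    calc 1 / (t : ℝ) * l ≤ 1 / (t : ℝ) * (κ * L ^ c₀) := by
          gcongr
          exact hlL.trans (le_mul_rpow_of_log_two_le (hl2.trans hlL) hc₀)
      _ = _ := by ring
  set mix := mixture (dataBefore pol obs t ω)
  have hmix : IsPolicy mix := Problem.mixture_policy ht0 hDpol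
  have hmixpos : ∀ s a, 0 < mix s a := Problem.mixture_pos ht0 hDpos
  set E := Real.exp (2 * P.R)
  have hE : 0 < E := Real.exp_pos _
  set B := max 1 P.R
  have hB1 : 1 ≤ B := le_max_left _ _
  have hBR : P.R ≤ B := le_max_right _ _
  have hv0 : 0 ≤ v := Real.sqrt_nonneg _
  -- Each branch of the minimum has its own comparator: the optimal policy here, the average online
  -- policy in the second case.
  rcases le_total (P.cov (P.opt P.rstar) mix) (√(max 1 CPi) / α) with hle | hle
  · rw [min_eq_left hle]
    refine le_trans ?_ (hlow _ (subset_convexHull ℝ _ hG.realizable))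
    have hcov0 : 0 ≤ P.cov (P.opt P.rstar) mix :=
      P.cov_nonneg (fun s a => (P.opt_pos _ s a).le) fun s a => (hmixpos s a).le
    generalize P.cov (P.opt P.rstar) mix = Cv at *
    have : 5 * c * E * Cv * √(1 / (t : ℝ) * l)
        ≤ (2 * COL + 10 * c * √κ) * (B * E) * Cv * v := by
      calc _ ≤ 5 * c * E * Cv * (√κ * v) := by gcongr
        _ = (5 * c * √κ) * (1 * E) * Cv * v := by ring
        _ ≤ _ := by
          gcongr
          have : 0 ≤ c * √κ := by positivity
          linarith
    linarith
  · rw [min_eq_right hle]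
    set j := (t / N + 1) * q with hj
    have hj0 : 0 < j := Nat.mul_pos (Nat.succ_pos _) hq
    have hj0' : (0 : ℝ) < j := by positivity
    have hjK : j ≤ K * q := Nat.mul_le_mul_right _ (Nat.div_lt_of_lt_mul (by rwa [mul_comm]))
    -- Since `t < (t / N + 1) N` and `αN ≤ 2 q`, online rounds make up at least a fraction `α / 2`;
    -- the factor `2` is the cost of rounding `αN` down.
    have htj : (t : ℝ) ≤ 2 / α * j := by
      have h1 : t < (t / N + 1) * N := by
        rw [mul_comm]; exact Nat.lt_mul_div_succ t (by exact_mod_cast hN0)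
      have h2 : (t : ℝ) ≤ ((t / N : ℕ) + 1) * N := by exact_mod_cast h1.le
      have h3 : (j : ℝ) = ((t / N : ℕ) + 1) * q := by rw [hj]; push_cast; ring
      rw [h3, div_mul_eq_mul_div, le_div_iff₀ hα]
      calc (t : ℝ) * α ≤ ((t / N : ℕ) + 1) * N * α := by gcongr
        _ = ((t / N : ℕ) + 1) * (α * N) := by ring
        _ ≤ ((t / N : ℕ) + 1) * (2 * q) := by gcongr
        _ = _ := by ring
    have hα2 : 1 ≤ 2 / α := by rw [le_div_iff₀ hα]; linarith
    set p : ℕ → Policy S A := fun i => pol (olTime N q i) ω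
    have hpmem : ∀ i < j, p i ∈ convexHull ℝ (Pi : Set (Policy S A)) := fun i hi =>
      hmem i (hi.trans_le hjK)
    have hbar := averagePolicy_mem hj0 hpmem
    have hJ := P.sub_div_le_J_averagePolicy hj0
      (fun i hi s a => ((hG.policy_pos_of_mem_convexHull (hpmem i hi)).2 s a).le) (hregret j hjK)
    have hcov : P.cov (averagePolicy p j) mix ≤ 2 / α :=
      P.cov_le_of_le_mul (hG.policy_pos_of_mem_convexHull hbar).1 hmixpos
        (averagePolicy_comp_le (p := fun i => pol i ω) hj0 (fun _ => rfl)
          (fun i hi s a => ((hpol i (hi.trans ht)).2 s a).le) (olTime_strictMono hq hqN)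
          (fun i hi => olTime_lt_of_le_mod hq hqN htN hi) htj)
    have hlow' := hlow _ hbar
    have h1 : 1 ≤ √(max 1 CPi) := Real.one_le_sqrt.mpr (le_max_left _ _)
    set Λ := Real.log (Pi.card * (K * q : ℕ) / δ₀)
    have hΛ0 : 0 ≤ Λ := by
      apply Real.log_nonneg
      rw [le_div_iff₀ hδ₀]; nlinarith
    have hΛL : Λ ≤ L := by
      have : (0 : ℝ) < (K * q : ℕ) := by linarith
      apply Real.log_le_log (by positivity)
      gcongr
    have hsqrt := sqrt_mul_le_of_le (C := CPi) hj0' ht0' hα2 htj (Real.rpow_nonneg hΛ0 c₀)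
      (Real.rpow_le_rpow hΛ0 hΛL (by linarith))
    rw [← hv] at hsqrt
    have hR0 := P.R_nonneg
    have hreg : COL * P.R * E * √(CPi * j * Λ ^ c₀) / j
        ≤ 2 * COL * (B * E) * (√(max 1 CPi) / α) * v := by
      calc _ = COL * P.R * E * (√(CPi * j * Λ ^ c₀) / j) := by ring
        _ ≤ COL * B * E * (2 / α * √(max 1 CPi) * v) := by gcongr
        _ = _ := by ring
    have hest : 5 * c * E * P.cov (averagePolicy p j) mix * √(1 / (t : ℝ) * l)
        ≤ 10 * c * √κ * (B * E) * (√(max 1 CPi) / α) * v := by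
      calc _ ≤ 5 * c * E * (2 / α) * (√κ * v) := by gcongr
        _ = 10 * c * √κ * (1 * E) * (1 / α) * v := by ring
        _ ≤ _ := by gcongr
    linarith

end Call

end RLHF

end

/-! ### Union of the two failure events -/

theorem mainTheorem8 (c COL c₀ : ℝ) (hc : √24 ≤ c) (hCOL : 0 < COL) (hc₀ : 1 ≤ c₀) :
    ∃ c' : ℝ, 0 < c' ∧
      ∀ (S : Type u) (A : Type v) [Fintype S] [Fintype A] (P : RLHF.Problem S A)
        (Pi : Finset (RLHF.Policy S A)) (_ : P.GoodClass Pi) (CPi : ℝ)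
        (alg : ℕ → ℝ → RLHF.OnlineRule S A)
        (_ : RLHF.IsNoRegret.{u, v, w} P Pi COL c₀ CPi alg)
        (W : ℕ) (src : Fin W → RLHF.Reward S A)
        (K N : ℕ) (α : ℝ) (_ : 0 < α) (_ : α < 1) (_ : 1 ≤ α * N)
        (δ δ₀ : ℝ) (_ : δ < 1) (_ : 0 < δ₀) (_ : δ₀ ≤ δ)
        (Ω : Type w) [mΩ : MeasurableSpace Ω] (μ : Measure Ω) [IsProbabilityMeasure μ]
        (𝓕 : Filtration ℕ mΩ) (pol : ℕ → Ω → RLHF.Policy S A) (obs : ℕ → Ω → RLHF.Obs S A)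
        (_ : RLHF.IsTPORun P Pi src alg K N α c δ δ₀ μ 𝓕 pol obs),
        μ {ω | ¬ ∀ t < K * N, ⌊α * N⌋₊ ≤ t % N →
          ∀ (rMLE : RLHF.Reward S A) (πD : RLHF.Policy S A) (rD : RLHF.Reward S A),
            P.IsTPSCall Pi c δ (K * N) (RLHF.dataBefore pol obs t ω) rMLE πD rD →
            P.J (P.opt P.rstar) - P.J P.πref
                - c' * (max 1 P.R * Real.exp (2 * P.R)) *
                  min (P.cov (P.opt P.rstar) (RLHF.mixture (RLHF.dataBefore pol obs t ω)))
                    (√(max 1 CPi) / α) *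
                  √(1 / (t : ℝ) * Real.log (Pi.card * (K * N : ℕ) / δ₀) ^ c₀)
              ≤ P.vhatDstl Pi c δ (K * N) (RLHF.dataBefore pol obs t ω) rMLE πD rD ∧
            P.vhatDstl Pi c δ (K * N) (RLHF.dataBefore pol obs t ω) rMLE πD rD
              ≤ P.J πD - P.J P.πref}
          ≤ ENNReal.ofReal (δ / 2 + δ₀) := by
  have hc0 : 0 < c := lt_of_lt_of_le (by positivity) hc
  -- `2 * COL` is the averaged regret with the factor `2 / α`; `10 c` is `5 c` times the coverage
  -- bound `2 / α`; the root is the price of raising the logarithm to the power `c₀`.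
  refine ⟨2 * COL + 10 * c * √(Real.log 2 ^ (1 - c₀)), by positivity, ?_⟩
  intro S A _ _ P Pi hG CPi alg halg W src K N α hα hα1 hαN δ δ₀ hδ1 hδ₀ hδ₀δ Ω mΩ μ _ 𝓕 pol obs hrun
  have hδ : 0 < δ := hδ₀.trans_le hδ₀δ
  have hN0 : (0 : ℝ) < N := by
    by_contra h
    have : α * N ≤ 0 := mul_nonpos_of_nonneg_of_nonpos hα.le (not_lt.mp h)
    linarith
  have hq : 0 < ⌊α * N⌋₊ := Nat.floor_pos.mpr hαN
  have hqN : ⌊α * N⌋₊ < N := by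
    rw [Nat.floor_lt (by positivity)]; nlinarith
  rcases Nat.eq_zero_or_pos K with rfl | hK
  · simp
  have hpol : ∀ᵐ ω ∂μ, ∀ i < K * N, RLHF.IsPolicy (pol i ω) ∧ ∀ s a, 0 < pol i ω s a := by
    rw [ae_all_iff]; intro i
    rw [Filter.eventually_imp_distrib_left]
    exact fun hi => hrun.ae_policy_pos hG halg hq hqN hi
  have hmem : ∀ᵐ ω ∂μ, ∀ j < K * ⌊α * N⌋₊,
      pol (RLHF.olTime N ⌊α * N⌋₊ j) ω ∈ convexHull ℝ (Pi : Set (RLHF.Policy S A)) := by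
    rw [ae_all_iff]; intro j
    rw [Filter.eventually_imp_distrib_left]
    exact fun hj => hrun.ae_online_mem halg hq hqN hj
  have hconc := RLHF.measure_not_concentrates_le (Pi := Pi) hrun.pol_meas hrun.obs_meas hrun.obs_law
    (fun t ht => (hrun.ae_policy_pos hG halg hq hqN ht).mono fun ω h => h.1) hδ hδ1
    (by nlinarith) ⟨_, hG.realizable⟩
  have hreg := halg.regret _ δ₀ hδ₀ (hδ₀δ.trans_lt hδ1) Ω μ _ _ _ (hrun.isOnlineRun hq hqN)
  rw [ENNReal.ofReal_add (by positivity) hδ₀.le]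
  -- The inclusion of events holds only almost everywhere, since membership in the hull and
  -- positivity of the policies do.
  refine le_trans (measure_mono_ae ?_) ((measure_union_le _ _).trans (add_le_add hconc hreg))
  filter_upwards [hpol, hmem] with ω h1 h2 h3
  by_contra h4
  have h5 := not_or.mp h4
  have h6 := not_not.mp h5.1
  have h7 := not_not.mp h5.2
  refine h3 fun t ht htN rMLE πD rD hcall => ?_
  exact RLHF.estimate_bounds hc hCOL hc₀ hG hα hα1 hαN hδ1 hδ₀ hδ₀δ h1 h2 h7 ht htN (h6 t ht) hcall
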